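/- Let $\Gamma$ be a finite simple graph with vertex set $V\Gamma$, let $G_\Gamma=\langle V\Gamma \mid [v,w]=1 \text{ if } v,w \text{ are adjacent}\rangle$ be the associated right-angled Artin group, and let $\widetilde S_\Gamma$ be the universal cover of the Salvetti complex $S_\Gamma$ (the cube complex with one $|\sigma|$-cube, glued up to a torus, for every clique $\sigma$ of $\Gamma$). Thus $\widetilde S_\Gamma$ is a CAT(0) cube complex on which $G_\Gamma$ acts by deck transformations, and whose 1-skeleton is the Cayley graph of $G_\Gamma$ with respect to $V\Gamma$. Let $\mathfrak H$ be the set of halfspaces of $\widetilde S_\Gamma$; the hyperplane bounding $h\in\mathfrak H$ is denoted by $\partial h$. Embed the vertex set of $\widetilde S_\Gamma$ in $\{0,1\}^{\mathfrak H}$ (with the product topology) by sending $x$ to the indicator function of $\{h: x\in h\}$. The Roller boundary $\partial_R\widetilde S_\Gamma$ is the closure of the image minus the image, with its Borel $\sigma$-algebra; for $\xi\in\partial_R\widetilde S_\Gamma$ let $U_\xi=\{h\in\mathfrak H:\xi(h)=1\}$. Two hyperplanes are strongly separated if no hyperplane intersects both of them. A point $\xi$ is regular if for all $h_1,h_2\in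 U_\xi$ there is $k\in U_\xi$ with $k\subseteq h_1\cap h_2$ such that $\partial k$ is strongly separated from $\partial h_1$ and from $\partial h_2$; let $\partial_{\mathrm{reg}}\widetilde S_\Gamma$ be the set of regular points. A geodesic ray $r$ in the 1-skeleton, starting at a vertex (a combinatorial geodesic ray), represents $\xi$ if $U_\xi$ is the set of halfspaces that virtually contain $r$, i.e. contain $r$ up to a finite initial segment. For a full subgraph $\Lambda\subseteq\Gamma$, a standard subcomplex of type $\Lambda$ is a connected component of the inverse image of $S_\Lambda\subseteq S_\Gamma$ in $\widetilde S_\Gamma$; it is a join standard subcomplex if $\Lambda$ is the join of two nonempty full subgraphs. Let $\mathbb S_J$ be the countable set, with the discrete topology, of all standard subcomplexes that are contained in some join standard subcomplex. Then: 1. $\partial_{\mathrm{reg}}\widetilde S_\Gamma$ is a Borel subset of $\partial_R\widetilde S_\Gamma$. 2. For every non-regular point $\xi\in\partial_R\widetilde S_\Gamma$ there is a unique standard subcomplex $Y$ such that, for every combinatorial geodesic ray $r$ representing $\xi$, $Y$ is the smallest standard subcomplex that virtually contains $r$. 3. There is a unique Borel $G_\Gamma$-equivariant map $\Phi:\partial_R\widetilde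 S_\Gamma\setminus\partial_{\mathrm{reg}}\widetilde S_\Gamma\to\mathbb S_J$ such that, for every non-regular point $\xi$ and every combinatorial geodesic ray $r$ representing $\xi$, $\Phi(\xi)$ is the smallest standard subcomplex of $\widetilde S_\Gamma$ that virtually contains $r$. -/

import Mathlib

open scoped Pointwise

namespace Salvetti

universe u

variable {V : Type u}

/-! ### Right-angled Artin groups -/

/-- The relators `[v, w]`, one for every pair of adjacent vertices of `Γ`. -/
def relators (Γ : SimpleGraph V) : Set (FreeGroup V) :=
  {x | ∃ v w, Γ.Adj v w ∧
    x = FreeGroup.of v * FreeGroup.of w * (FreeGroup.of v)⁻¹ * (FreeGroup.of w)⁻¹}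

/-- The right-angled Artin group with defining graph `Γ`. -/
abbrev RAAG (Γ : SimpleGraph V) : Type u := PresentedGroup (relators Γ)

/-- The standard generator attached to a vertex of `Γ`. -/
def gen (Γ : SimpleGraph V) (v : V) : RAAG Γ := PresentedGroup.of v

/-- `Λ` (a set of vertices, standing for the full subgraph it spans) admits a nontrivial join
decomposition. -/
def IsJoin (Γ : SimpleGraph V) (Λ : Set V) : Prop :=
  ∃ A B : Set V, A.Nonempty ∧ B.Nonempty ∧ Disjoint A B ∧ A ∪ B = Λ ∧
    ∀ a ∈ A, ∀ b ∈ B, Γ.Adj a b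

/-! ### The Salvetti complex and its universal cover -/

/-- The cubes of the Salvetti complex of `Γ`: one cube for every clique `σ` of `Γ`, of dimension
`|σ|` (the empty clique is the only vertex, and a clique `σ` gives the torus spanned by the
loops `v ∈ σ`). For `v ∈ σ`, both faces of the cube `σ` in the direction `v` are glued
to the cube `σ \ {v}`. -/
def SalvettiCube (Γ : SimpleGraph V) : Type u := {σ : Set V // Γ.IsClique σ}

/-- The subcomplex of the Salvetti complex of `Γ` that is the Salvetti complex of the full subgraph
spanned by `Λ`. -/
def salvettiSub (Γ : SimpleGraph V) (Λ : Set V) : Set (SalvettiCube Γ) := {σ | σ.1 ⊆ Λ}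

/-- The cubes of the universal cover of the Salvetti complex. Its vertex set is the group, and
the lifts of the cube `σ` are indexed by the group: the lift based at `g` has as its vertices
the products `g * ∏ v ∈ τ, v` for `τ ⊆ σ`. -/
@[ext]
structure Cube (Γ : SimpleGraph V) where
  /-- the initial vertex of the cube -/
  base : RAAG Γ
  /-- the labels of the edges at the initial vertex -/
  dirs : Set V
  /-- the labels span a clique -/
  isClique : Γ.IsClique dirs

/-- The covering map from the universal cover to the Salvetti complex, on cubes. -/
def covering (Γ : SimpleGraph V) (c : Cube Γ) : SalvettiCube Γ := ⟨c.dirs, c.isClique⟩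

/-- `c'` is a codimension one face of `c`: one of the two faces of `c` orthogonal to a direction
`v` of `c`. -/
def IsFacet {Γ : SimpleGraph V} (c' c : Cube Γ) : Prop :=
  ∃ v ∈ c.dirs, c'.dirs = c.dirs \ {v} ∧ (c'.base = c.base ∨ c'.base = c.base * gen Γ v)

/-- The vertices, as cubes of dimension zero. -/
def vertexCube (Γ : SimpleGraph V) (g : RAAG Γ) : Cube Γ :=
  ⟨g, ∅, by simp [SimpleGraph.IsClique]⟩

/-- The edges of the universal cover: the edge with label `v` based at `g` joins `g` to `g * v`. -/
@[ext]
structure Edge (Γ : SimpleGraph V) where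
  /-- the initial vertex -/
  base : RAAG Γ
  /-- the label -/
  label : V

/-- An edge as a cube of dimension one. -/
def Edge.toCube {Γ : SimpleGraph V} (e : Edge Γ) : Cube Γ :=
  ⟨e.base, {e.label}, by simp [SimpleGraph.IsClique]⟩

/-- The pair of endpoints of an edge. -/
def Edge.ends {Γ : SimpleGraph V} (e : Edge Γ) : Sym2 (RAAG Γ) :=
  s(e.base, e.base * gen Γ e.label)

/-- The 1-skeleton of the universal cover; its path metric is `SimpleGraph.dist`. -/
def oneSkeleton (Γ : SimpleGraph V) : SimpleGraph (RAAG Γ) :=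
  SimpleGraph.fromEdgeSet (Set.range (Edge.ends (Γ := Γ)))

/-! ### Standard subcomplexes -/

/-- The connected component of the cube `c` in the subcomplex with set of cubes `S`. -/
def component {Γ : SimpleGraph V} (S : Set (Cube Γ)) (c : Cube Γ) : Set (Cube Γ) :=
  {c' | Relation.ReflTransGen
    (fun a b => a ∈ S ∧ b ∈ S ∧ (IsFacet a b ∨ IsFacet b a)) c c'}

/-- `Y` (a subcomplex, given by its cubes) is a standard subcomplex of type `Λ`: a connected
component of the inverse image of the Salvetti complex of `Λ` under the covering map. -/
def IsStandardOfType (Γ : SimpleGraph V) (Λ : Set V) (Y : Set (Cube Γ)) : Prop :=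
  ∃ c ∈ covering Γ ⁻¹' salvettiSub Γ Λ, Y = component (covering Γ ⁻¹' salvettiSub Γ Λ) c

/-- `Y` is a standard subcomplex. -/
def IsStandard (Γ : SimpleGraph V) (Y : Set (Cube Γ)) : Prop :=
  ∃ Λ : Set V, IsStandardOfType Γ Λ Y

/-- `Y` is a join standard subcomplex. -/
def IsJoinStandard (Γ : SimpleGraph V) (Y : Set (Cube Γ)) : Prop :=
  ∃ Λ : Set V, IsJoin Γ Λ ∧ IsStandardOfType Γ Λ Y

/-- The set of all standard subcomplexes that are contained in some join standard subcomplex. -/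
def StandardInJoin (Γ : SimpleGraph V) : Type u :=
  {Y : Set (Cube Γ) // IsStandard Γ Y ∧ ∃ Z, IsJoinStandard Γ Z ∧ Y ⊆ Z}

/-- The countable set `StandardInJoin Γ` is discrete. -/
instance (Γ : SimpleGraph V) : MeasurableSpace (StandardInJoin Γ) := ⊤

/-! ### Hyperplanes and halfspaces -/

/-- `e` and `e'` are opposite edges of a square: the square based at `e.base` whose directions are
the label of `e` and a vertex `w` adjacent to it. -/
def OppositeEdges {Γ : SimpleGraph V} (e e' : Edge Γ) : Prop :=
  e'.label = e.label ∧ ∃ w, Γ.Adj e.label w ∧ e'.base = e.base * gen Γ w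

/-- The hyperplanes: classes of edges under the equivalence relation generated by being opposite
in a square. -/
def Hyperplane (Γ : SimpleGraph V) : Type u := Quot (OppositeEdges (Γ := Γ))

/-- The hyperplane dual to an edge. -/
def Edge.dual {Γ : SimpleGraph V} (e : Edge Γ) : Hyperplane Γ := Quot.mk _ e

/-- Two hyperplanes have nonempty intersection: they are equal, or they are dual to two
adjacent edges of a square. -/
def Hyperplane.Meets {Γ : SimpleGraph V} (H K : Hyperplane Γ) : Prop :=
  H = K ∨ ∃ (g : RAAG Γ) (v w : V), Γ.Adj v w ∧
    Edge.dual ⟨g, v⟩ = H ∧ Edge.dual ⟨g, w⟩ = K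

/-- Two hyperplanes are strongly separated if no hyperplane meets both of them. -/
def StronglySeparated {Γ : SimpleGraph V} (H K : Hyperplane Γ) : Prop :=
  ¬ ∃ L : Hyperplane Γ, L.Meets H ∧ L.Meets K

/-- The 1-skeleton with the (open) edges dual to `H` removed. -/
def Hyperplane.complement {Γ : SimpleGraph V} (H : Hyperplane Γ) : SimpleGraph (RAAG Γ) :=
  (oneSkeleton Γ).deleteEdges (Edge.ends '' {e | e.dual = H})

/-- A halfspace: a connected component of the complement of a hyperplane, given by its
vertices. -/
@[ext]
structure Halfspace (Γ : SimpleGraph V) where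
  /-- the boundary hyperplane -/
  boundary : Hyperplane Γ
  /-- the vertices of the halfspace -/
  carrier : Set (RAAG Γ)
  /-- they form a connected component -/
  isComponent : ∃ x, carrier = {y | boundary.complement.Reachable x y}

/-! ### The action of the group by deck transformations -/

section action

variable {Γ : SimpleGraph V}

instance : MulAction (RAAG Γ) (Cube Γ) where
  smul g c := ⟨g * c.base, c.dirs, c.isClique⟩
  one_smul _ := Cube.ext (one_mul _) rfl
  mul_smul g h _ := Cube.ext (mul_assoc g h _) rfl

instance : MulAction (RAAG Γ) (Edge Γ) where
  smul g e := ⟨g * e.base, e.label⟩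
  one_smul _ := Edge.ext (one_mul _) rfl
  mul_smul g h _ := Edge.ext (mul_assoc g h _) rfl

theorem cube_smul_base (g : RAAG Γ) (c : Cube Γ) : (g • c).base = g * c.base := rfl

theorem cube_smul_dirs (g : RAAG Γ) (c : Cube Γ) : (g • c).dirs = c.dirs := rfl

theorem edge_smul_base (g : RAAG Γ) (e : Edge Γ) : (g • e).base = g * e.base := rfl

theorem edge_smul_label (g : RAAG Γ) (e : Edge Γ) : (g • e).label = e.label := rfl

theorem OppositeEdges.smul {e e' : Edge Γ} (h : OppositeEdges e e') (g : RAAG Γ) :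
    OppositeEdges (g • e) (g • e') := by
  obtain ⟨h1, w, hw, h2⟩ := h
  refine ⟨h1, w, hw, ?_⟩
  rw [edge_smul_base, edge_smul_base, h2, mul_assoc]

instance : MulAction (RAAG Γ) (Hyperplane Γ) where
  smul g := Quot.map (g • ·) fun _ _ h => h.smul g
  one_smul H := by
    induction H using Quot.ind with
    | mk e => exact congrArg (Quot.mk _) (one_smul _ e)
  mul_smul g h H := by
    induction H using Quot.ind with
    | mk e => exact congrArg (Quot.mk _) (mul_smul g h e)

theorem smul_dual (g : RAAG Γ) (e : Edge Γ) : g • e.dual = (g • e).dual := rfl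

theorem Hyperplane.Meets.smul {H K : Hyperplane Γ} (h : H.Meets K) (g : RAAG Γ) :
    (g • H).Meets (g • K) := by
  rcases h with h | ⟨x, v, w, hvw, rfl, rfl⟩
  · exact Or.inl (by rw [h])
  · exact Or.inr ⟨g * x, v, w, hvw, rfl, rfl⟩

theorem StronglySeparated.smul {H K : Hyperplane Γ} (h : StronglySeparated H K) (g : RAAG Γ) :
    StronglySeparated (g • H) (g • K) := by
  rintro ⟨L, h1, h2⟩
  refine h ⟨g⁻¹ • L, ?_, ?_⟩
  · simpa using h1.smul g⁻¹
  · simpa using h2.smul g⁻¹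

theorem ends_smul (g : RAAG Γ) (e : Edge Γ) : (g • e).ends = e.ends.map (g * ·) := by
  simp [Edge.ends, edge_smul_base, edge_smul_label, mul_assoc]

theorem ends_eq_smul {g x y : RAAG Γ} {e : Edge Γ} :
    e.ends = s(g * x, g * y) ↔ (g⁻¹ • e).ends = s(x, y) := by
  rw [ends_smul]
  constructor
  · intro h
    simp [h]
  · intro h
    have := congrArg (Sym2.map (g * ·)) h
    simpa [Sym2.map_map, Function.comp_def] using this

theorem oneSkeleton_adj_smul (g x y : RAAG Γ) (h : (oneSkeleton Γ).Adj x y) :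
    (oneSkeleton Γ).Adj (g * x) (g * y) := by
  rw [oneSkeleton, SimpleGraph.fromEdgeSet_adj] at h ⊢
  obtain ⟨⟨e, he⟩, hne⟩ := h
  refine ⟨⟨g • e, ?_⟩, by simpa using hne⟩
  rw [ends_smul, he, Sym2.map_mk]

theorem complement_adj_smul {H : Hyperplane Γ} (g x y : RAAG Γ) (h : H.complement.Adj x y) :
    (g • H).complement.Adj (g * x) (g * y) := by
  rw [Hyperplane.complement, SimpleGraph.deleteEdges_adj] at h ⊢
  refine ⟨oneSkeleton_adj_smul g x y h.1, ?_⟩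
  rintro ⟨e, he, hxy⟩
  refine h.2 ⟨g⁻¹ • e, ?_, ends_eq_smul.1 hxy⟩
  change (g⁻¹ • e).dual = H
  rw [← smul_dual, show e.dual = g • H from he, inv_smul_smul]

theorem complement_reachable_smul {H : Hyperplane Γ} (g : RAAG Γ) {x y : RAAG Γ}
    (h : H.complement.Reachable x y) : (g • H).complement.Reachable (g * x) (g * y) :=
  h.map ⟨fun z => g * z, fun {a b} hab => complement_adj_smul g a b hab⟩

instance : SMul (RAAG Γ) (Halfspace Γ) where
  smul g h := ⟨g • h.boundary, g • h.carrier, by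
    obtain ⟨x, hx⟩ := h.isComponent
    refine ⟨g * x, ?_⟩
    ext y
    rw [Set.mem_smul_set_iff_inv_smul_mem, hx]
    constructor
    · intro hy
      simpa using complement_reachable_smul g hy
    · intro hy
      simpa using complement_reachable_smul g⁻¹ hy⟩

theorem smul_boundary (g : RAAG Γ) (h : Halfspace Γ) :
    (g • h).boundary = g • h.boundary := rfl

theorem smul_carrier (g : RAAG Γ) (h : Halfspace Γ) :
    (g • h).carrier = g • h.carrier := rfl

instance : MulAction (RAAG Γ) (Halfspace Γ) where
  one_smul _ := Halfspace.ext (one_smul _ _) (one_smul _ _)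
  mul_smul _ _ _ := Halfspace.ext (mul_smul _ _ _) (mul_smul _ _ _)

theorem IsFacet.smul {c c' : Cube Γ} (h : IsFacet c c') (g : RAAG Γ) :
    IsFacet (g • c) (g • c') := by
  obtain ⟨v, hv, hd, hb⟩ := h
  refine ⟨v, hv, hd, ?_⟩
  simp only [cube_smul_base]
  rcases hb with hb | hb
  · exact Or.inl (by rw [hb])
  · exact Or.inr (by rw [hb, mul_assoc])

theorem component_smul_subset {Λ : Set V} (g : RAAG Γ) (c c' : Cube Γ)
    (h : c' ∈ component (covering Γ ⁻¹' salvettiSub Γ Λ) c) :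
    g • c' ∈ component (covering Γ ⁻¹' salvettiSub Γ Λ) (g • c) := by
  refine Relation.ReflTransGen.lift (g • · : Cube Γ → Cube Γ) ?_ _ _ h
  rintro a b ⟨ha, hb, hab⟩
  exact ⟨ha, hb, hab.imp (fun h => h.smul g) (fun h => h.smul g)⟩

theorem IsStandardOfType.smul {Λ : Set V} {Y : Set (Cube Γ)} (h : IsStandardOfType Γ Λ Y)
    (g : RAAG Γ) : IsStandardOfType Γ Λ (g • Y) := by
  obtain ⟨c, hc, rfl⟩ := h
  refine ⟨g • c, hc, ?_⟩
  ext c'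
  rw [Set.mem_smul_set_iff_inv_smul_mem]
  constructor
  · intro h
    simpa using component_smul_subset g _ _ h
  · intro h
    simpa using component_smul_subset g⁻¹ _ _ h

instance : MulAction (RAAG Γ) (StandardInJoin Γ) where
  smul g Y := ⟨g • Y.1, Y.2.1.imp fun _ h => h.smul g, by
    obtain ⟨Z, ⟨Λ, hΛ, hZ⟩, hYZ⟩ := Y.2.2
    exact ⟨g • Z, ⟨Λ, hΛ, hZ.smul g⟩, Set.smul_set_mono hYZ⟩⟩
  one_smul _ := Subtype.ext (one_smul _ _)
  mul_smul _ _ _ := Subtype.ext (mul_smul _ _ _)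

end action

/-! ### The Roller boundary -/

open Classical in
/-- The map that sends a vertex `x` to the indicator of the set of halfspaces containing `x`. The
space `Halfspace Γ → Bool` carries the product topology. -/
noncomputable def vertexEmbedding (Γ : SimpleGraph V) (x : RAAG Γ) : Halfspace Γ → Bool :=
  fun h => decide (x ∈ h.carrier)

/-- The Roller boundary: the complement of the vertex set in its closure. -/
def RollerBoundary (Γ : SimpleGraph V) : Type u :=
  {ξ : Halfspace Γ → Bool //
    ξ ∈ closure (Set.range (vertexEmbedding Γ)) \ Set.range (vertexEmbedding Γ)}

instance (Γ : SimpleGraph V) : TopologicalSpace (RollerBoundary Γ) :=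
  inferInstanceAs (TopologicalSpace {ξ : Halfspace Γ → Bool //
    ξ ∈ closure (Set.range (vertexEmbedding Γ)) \ Set.range (vertexEmbedding Γ)})

instance (Γ : SimpleGraph V) : MeasurableSpace (RollerBoundary Γ) := borel _

instance (Γ : SimpleGraph V) : BorelSpace (RollerBoundary Γ) := ⟨rfl⟩

/-- The set of halfspaces selected by a boundary point. -/
def RollerBoundary.halfspaces {Γ : SimpleGraph V} (ξ : RollerBoundary Γ) : Set (Halfspace Γ) :=
  {h | ξ.1 h = true}

/-- The regular points of the Roller boundary. -/
def regularPoints (Γ : SimpleGraph V) : Set (RollerBoundary Γ) :=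
  {ξ | ∀ h₁ ∈ ξ.halfspaces, ∀ h₂ ∈ ξ.halfspaces, ∃ k ∈ ξ.halfspaces,
    k.carrier ⊆ h₁.carrier ∩ h₂.carrier ∧
    StronglySeparated k.boundary h₁.boundary ∧ StronglySeparated k.boundary h₂.boundary}

section boundaryAction

variable {Γ : SimpleGraph V}

/-- Translation of an indicator function on the set of halfspaces. -/
def translate (g : RAAG Γ) (ξ : Halfspace Γ → Bool) : Halfspace Γ → Bool := fun h => ξ (g⁻¹ • h)

theorem translate_vertexEmbedding (g x : RAAG Γ) :
    translate g (vertexEmbedding Γ x) = vertexEmbedding Γ (g * x) := by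
  funext h
  simp [translate, vertexEmbedding, smul_carrier, Set.mem_smul_set_iff_inv_smul_mem]

theorem translate_translate (g h : RAAG Γ) (ξ : Halfspace Γ → Bool) :
    translate g (translate h ξ) = translate (g * h) ξ := by
  funext k
  simp [translate, mul_smul]

theorem translate_one (ξ : Halfspace Γ → Bool) : translate 1 ξ = ξ := by
  funext k
  simp [translate]

theorem translate_mem (g : RAAG Γ) {ξ : Halfspace Γ → Bool}
    (h : ξ ∈ closure (Set.range (vertexEmbedding Γ)) \ Set.range (vertexEmbedding Γ)) :
    translate g ξ ∈
      closure (Set.range (vertexEmbedding Γ)) \ Set.range (vertexEmbedding Γ) := by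
  constructor
  · refine map_mem_closure (f := translate g) (continuous_pi fun k => continuous_apply _) h.1 ?_
    rintro _ ⟨x, rfl⟩
    exact ⟨g * x, (translate_vertexEmbedding g x).symm⟩
  · rintro ⟨x, hx⟩
    refine h.2 ⟨g⁻¹ * x, ?_⟩
    rw [← translate_vertexEmbedding, hx, translate_translate, inv_mul_cancel, translate_one]

instance : MulAction (RAAG Γ) (RollerBoundary Γ) where
  smul g ξ := ⟨translate g ξ.1, translate_mem g ξ.2⟩
  one_smul _ := Subtype.ext (translate_one _)
  mul_smul g h _ := Subtype.ext (translate_translate g h _).symm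

theorem mem_halfspaces_smul {g : RAAG Γ} {ξ : RollerBoundary Γ} {h : Halfspace Γ} :
    h ∈ (g • ξ).halfspaces ↔ g⁻¹ • h ∈ ξ.halfspaces := Iff.rfl

theorem regularPoints_smul (g : RAAG Γ) {ξ : RollerBoundary Γ} (hξ : ξ ∈ regularPoints Γ) :
    g • ξ ∈ regularPoints Γ := by
  intro h₁ hh₁ h₂ hh₂
  obtain ⟨k, hk, hsub, h1, h2⟩ := hξ _ (mem_halfspaces_smul.1 hh₁) _ (mem_halfspaces_smul.1 hh₂)
  refine ⟨g • k, mem_halfspaces_smul.2 (by simpa using hk), ?_, ?_, ?_⟩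
  · have := Set.smul_set_mono (a := g) hsub
    simpa [Set.smul_set_inter, smul_carrier] using this
  · simpa [smul_boundary] using h1.smul g
  · simpa [smul_boundary] using h2.smul g

end boundaryAction

/-- The space of non-regular points, a subspace of the Roller boundary. -/
abbrev NonRegular (Γ : SimpleGraph V) : Type u := {ξ : RollerBoundary Γ // ξ ∉ regularPoints Γ}

instance (Γ : SimpleGraph V) : MulAction (RAAG Γ) (NonRegular Γ) where
  smul g ξ := ⟨g • ξ.1, fun h => ξ.2 (by simpa using regularPoints_smul g⁻¹ h)⟩
  one_smul _ := Subtype.ext (one_smul _ _)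
  mul_smul _ _ _ := Subtype.ext (mul_smul _ _ _)

/-! ### Combinatorial geodesic rays -/

/-- `r` is (the sequence of vertices of) a geodesic ray in the 1-skeleton. -/
def IsGeodesicRay (Γ : SimpleGraph V) (r : ℕ → RAAG Γ) : Prop :=
  ∀ m n, (oneSkeleton Γ).dist (r m) (r (m + n)) = n

/-- The ray `r` represents the boundary point `ξ`: the halfspaces selected by `ξ` are those which
contain `r` up to a finite segment. -/
def Represents {Γ : SimpleGraph V} (r : ℕ → RAAG Γ) (ξ : RollerBoundary Γ) : Prop :=
  ∀ h : Halfspace Γ, h ∈ ξ.halfspaces ↔ ∃ N, ∀ n ≥ N, r n ∈ h.carrier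

/-- The subcomplex `Y` virtually contains `r`: it contains all the vertices and edges of `r` up to a
finite segment. -/
def VirtuallyContains {Γ : SimpleGraph V} (Y : Set (Cube Γ)) (r : ℕ → RAAG Γ) : Prop :=
  ∃ N, ∀ n ≥ N, vertexCube Γ (r n) ∈ Y ∧
    ∀ e : Edge Γ, e.ends = s(r n, r (n + 1)) → e.toCube ∈ Y

/-- For every combinatorial geodesic ray `r` representing `ξ`, the subcomplex `Y` is the smallest
standard subcomplex that virtually contains `r`. -/
def IsSmallestFor {Γ : SimpleGraph V} (Y : Set (Cube Γ)) (ξ : RollerBoundary Γ) : Prop :=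
  ∀ r : ℕ → RAAG Γ, IsGeodesicRay Γ r → Represents r ξ →
    IsLeast {Z : Set (Cube Γ) | IsStandard Γ Z ∧ VirtuallyContains Z r} Y

end Salvetti

/-!
Crossing an edge of label `v` multiplies a vertex by `v` or `v⁻¹`, so two vertices lie in the same
standard subcomplex of type `Λ` as soon as all hyperplanes that separate them have labels in `Λ`.
A ray is therefore virtually contained in such a subcomplex if and only if some vertex of the
subcomplex is separated from its limit point `ξ` by hyperplanes with labels in `Λ` only. This
condition does not mention the ray, it is equivariant, and it is a countable Boolean combination of
the clopen conditions `h ∈ ξ.halfspaces`. The smallest standard subcomplex has as its type the set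
of labels that occur infinitely often along the ray.

If this set `Λ` is not contained in a join, then the complement graph of `Λ` is connected and no
vertex is adjacent to all of `Λ`. Halfspaces that a ray enters along edges with non-adjacent labels
are nested. Following a path of the complement graph, the ray enters, inside a given halfspace `h`,
a nested sequence of halfspaces in whose labels all of `Λ` occurs. A hyperplane crossing the first
and the last of their boundaries crosses all of them, so that its label is adjacent to all of `Λ`,
which is impossible. Hence `ξ` is regular.
-/

namespace Salvetti

variable {V : Type*} {Γ : SimpleGraph V}

/-! ### Special subgroups -/

theorem commute_gen {v w : V} (h : Γ.Adj v w) : Commute (gen Γ v) (gen Γ w) := by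
  have hrel : PresentedGroup.mk (relators Γ) (FreeGroup.of v * FreeGroup.of w *
      (FreeGroup.of v)⁻¹ * (FreeGroup.of w)⁻¹) = 1 :=
    PresentedGroup.one_of_mem ⟨v, w, h, rfl⟩
  simp only [map_mul, map_inv] at hrel
  rwa [mul_inv_eq_one, mul_inv_eq_iff_eq_mul] at hrel

/-- The special subgroup of the right-angled Artin group generated by a set of vertices of `Γ`. The
vertex sets of the standard subcomplexes are the left cosets of the special subgroups. -/
def specialSubgroup (Γ : SimpleGraph V) (Λ : Set V) : Subgroup (RAAG Γ) :=
  Subgroup.closure (gen Γ '' Λ)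

theorem gen_mem_specialSubgroup {Λ : Set V} {v : V} (hv : v ∈ Λ) :
    gen Γ v ∈ specialSubgroup Γ Λ :=
  Subgroup.subset_closure ⟨v, hv, rfl⟩

theorem specialSubgroup_mono {Λ Λ' : Set V} (h : Λ ⊆ Λ') :
    specialSubgroup Γ Λ ≤ specialSubgroup Γ Λ' :=
  Subgroup.closure_mono (Set.image_mono h)

theorem specialSubgroup_univ : specialSubgroup Γ Set.univ = ⊤ := by
  rw [specialSubgroup, Set.image_univ]
  exact PresentedGroup.closure_range_of _

theorem rel_mul_of_mem_specialSubgroup (s : Setoid (RAAG Γ)) {Λ : Set V} {x u : RAAG Γ}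
    (step : ∀ u ∈ specialSubgroup Γ Λ, ∀ v ∈ Λ, s (x * u) (x * u * gen Γ v))
    (hu : u ∈ specialSubgroup Γ Λ) : s x (x * u) := by
  induction hu using Subgroup.closure_induction_right with
  | one => rw [mul_one]
  | mul_right u hu _ hv ih =>
    obtain ⟨v, hv, rfl⟩ := hv
    rw [← mul_assoc]
    exact s.trans ih (step u hu v hv)
  | mul_inv_cancel u hu _ hv ih =>
    obtain ⟨v, hv, rfl⟩ := hv
    have hback := step (u * (gen Γ v)⁻¹) (mul_mem hu (inv_mem (gen_mem_specialSubgroup hv))) v hv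
    rw [← mul_assoc, inv_mul_cancel_right] at hback
    rw [← mul_assoc]
    exact s.trans ih (s.symm hback)

theorem apply_mul_eq_of_mem_specialSubgroup {α : Type*} (f : RAAG Γ → α) {Λ : Set V}
    {x u : RAAG Γ}
    (step : ∀ u ∈ specialSubgroup Γ Λ, ∀ v ∈ Λ, f (x * u * gen Γ v) = f (x * u))
    (hu : u ∈ specialSubgroup Γ Λ) : f (x * u) = f x :=
  (rel_mul_of_mem_specialSubgroup (Setoid.ker f) (fun u hu v hv => (step u hu v hv).symm) hu).symm

theorem commute_gen_of_mem_specialSubgroup {v : V} {u : RAAG Γ}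
    (hu : u ∈ specialSubgroup Γ (Γ.neighborSet v)) : Commute (gen Γ v) u := by
  have hle : specialSubgroup Γ (Γ.neighborSet v) ≤ Subgroup.centralizer {gen Γ v} := by
    rw [specialSubgroup, Subgroup.closure_le]
    rintro _ ⟨w, hw, rfl⟩
    exact Subgroup.mem_centralizer_singleton_iff.2 (commute_gen hw).symm
  exact (Subgroup.mem_centralizer_singleton_iff.1 (hle hu)).symm

/-! ### Hyperplanes -/

/-- The common label of the edges dual to a hyperplane. -/
def Hyperplane.label (H : Hyperplane Γ) : V := Quot.lift Edge.label (fun _ _ h => h.1.symm) H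

@[simp] theorem label_dual (e : Edge Γ) : e.dual.label = e.label := rfl

theorem dual_mul_gen {g : RAAG Γ} {v w : V} (h : Γ.Adj v w) :
    Edge.dual ⟨g * gen Γ w, v⟩ = Edge.dual ⟨g, v⟩ :=
  (Quot.sound ⟨rfl, w, h, rfl⟩).symm

theorem dual_eq_dual_iff {e e' : Edge Γ} : e.dual = e'.dual ↔
    ∃ u ∈ specialSubgroup Γ (Γ.neighborSet e.label), e' = ⟨e.base * u, e.label⟩ := by
  constructor
  · intro h
    have hgen := Quot.eqvGen_exact h
    clear h
    induction hgen with
    | rel e e' h =>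
      obtain ⟨hl, w, hw, hb⟩ := h
      exact ⟨gen Γ w, gen_mem_specialSubgroup hw, Edge.ext hb hl⟩
    | refl e => exact ⟨1, one_mem _, by rw [mul_one]⟩
    | symm e e' _ ih =>
      obtain ⟨u, hu, rfl⟩ := ih
      exact ⟨u⁻¹, inv_mem hu, by rw [mul_inv_cancel_right]⟩
    | trans e e' e'' _ _ ih ih' =>
      obtain ⟨u, hu, rfl⟩ := ih
      obtain ⟨u', hu', rfl⟩ := ih'
      exact ⟨u * u', mul_mem hu hu', by rw [mul_assoc]⟩
  · rintro ⟨u, hu, rfl⟩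
    exact (apply_mul_eq_of_mem_specialSubgroup (fun g => Edge.dual ⟨g, e.label⟩)
      (fun _ _ _ hw => dual_mul_gen hw) hu).symm

/-! ### The two sides of a hyperplane -/

open Classical in
/-- The value of `sideHom` on a generator: the only hyperplane separating `gen Γ v` from `1` is the
one dual to the edge between them. -/
noncomputable def sideGen (Γ : SimpleGraph V) (v : V) :
    (Hyperplane Γ → Multiplicative (ZMod 2)) ⋊[mulAutArrow] RAAG Γ :=
  ⟨fun H => Multiplicative.ofAdd (if Edge.dual ⟨1, v⟩ = H then 1 else 0), gen Γ v⟩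

open Classical in
theorem mulAutArrow_sideGen_left (g : RAAG Γ) (v : V) (H : Hyperplane Γ) :
    (mulAutArrow g (sideGen Γ v).left : Hyperplane Γ → Multiplicative (ZMod 2)) H =
      Multiplicative.ofAdd (if Edge.dual ⟨g, v⟩ = H then 1 else 0) := by
  have hdual : g • Edge.dual (⟨1, v⟩ : Edge Γ) = Edge.dual ⟨g, v⟩ :=
    congrArg Edge.dual (Edge.ext (mul_one g) rfl)
  change Multiplicative.ofAdd (if Edge.dual ⟨1, v⟩ = g⁻¹ • H then 1 else 0) = _
  simp only [eq_inv_smul_iff, hdual]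

theorem mulAutArrow_gen_sideGen_left {v w : V} (h : Γ.Adj v w) :
    mulAutArrow (gen Γ v) (sideGen Γ w).left = (sideGen Γ w).left := by
  have hdual : Edge.dual ⟨gen Γ v, w⟩ = Edge.dual ⟨1, w⟩ := by
    simpa only [one_mul] using dual_mul_gen (g := 1) h.symm
  funext H
  rw [mulAutArrow_sideGen_left, hdual, sideGen]

theorem lift_sideGen_of_mem_relators :
    ∀ r ∈ relators Γ, FreeGroup.lift (sideGen Γ) r = 1 := by
  rintro _ ⟨v, w, h, rfl⟩
  simp only [map_mul, map_inv, FreeGroup.lift_apply_of]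
  rw [mul_inv_eq_one, mul_inv_eq_iff_eq_mul]
  refine SemidirectProduct.ext ?_ (commute_gen h)
  change (sideGen Γ v).left * mulAutArrow (gen Γ v) (sideGen Γ w).left =
    (sideGen Γ w).left * mulAutArrow (gen Γ w) (sideGen Γ v).left
  rw [mulAutArrow_gen_sideGen_left h, mulAutArrow_gen_sideGen_left h.symm, mul_comm]

/-- The homomorphism whose first component is the indicator of the set of hyperplanes that separate
a group element from `1`; this indicator is a cocycle, whence the semidirect product. -/
noncomputable def sideHom (Γ : SimpleGraph V) :
    RAAG Γ →* (Hyperplane Γ → Multiplicative (ZMod 2)) ⋊[mulAutArrow] RAAG Γ :=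
  PresentedGroup.toGroup lift_sideGen_of_mem_relators

theorem sideHom_gen (v : V) : sideHom Γ (gen Γ v) = sideGen Γ v :=
  PresentedGroup.toGroup.of _

theorem sideHom_right (g : RAAG Γ) : (sideHom Γ g).right = g := by
  have hid : SemidirectProduct.rightHom.comp (sideHom Γ) = MonoidHom.id _ :=
    PresentedGroup.ext fun v => congrArg SemidirectProduct.right (sideHom_gen v)
  exact DFunLike.congr_fun hid g

/-- The side of the hyperplane `H` on which the vertex `g` lies; the side of `1` is `0`. -/
noncomputable def Hyperplane.side (H : Hyperplane Γ) (g : RAAG Γ) : ZMod 2 :=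
  Multiplicative.toAdd ((sideHom Γ g).left H)

/-- The hyperplane `H` separates the vertices `x` and `y`. -/
abbrev Hyperplane.Separates (H : Hyperplane Γ) (x y : RAAG Γ) : Prop := H.side x ≠ H.side y

theorem Hyperplane.Separates.side_eq {H : Hyperplane Γ} {x y z : RAAG Γ} (h : H.Separates x y)
    (h' : H.Separates x z) : H.side y = H.side z := by
  have hbit : ∀ a b c : ZMod 2, a ≠ b → a ≠ c → b = c := by decide
  exact hbit _ _ _ h h'

open Classical in
theorem Hyperplane.side_mul_gen (H : Hyperplane Γ) (g : RAAG Γ) (v : V) :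
    H.side (g * gen Γ v) = H.side g + if Edge.dual ⟨g, v⟩ = H then 1 else 0 := by
  rw [side, map_mul, SemidirectProduct.mul_left, sideHom_right, sideHom_gen, Pi.mul_apply,
    mulAutArrow_sideGen_left, toAdd_mul, toAdd_ofAdd, side]

theorem Hyperplane.separates_mul_gen_iff {H : Hyperplane Γ} {g : RAAG Γ} {v : V} :
    H.Separates g (g * gen Γ v) ↔ Edge.dual ⟨g, v⟩ = H := by
  rw [Separates, side_mul_gen, ne_comm, ne_eq, add_eq_left]
  split_ifs with h <;> simp [h]

theorem Hyperplane.side_mul_of_mem {H : Hyperplane Γ} {x u : RAAG Γ}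
    (hu : u ∈ specialSubgroup Γ (Γ.neighborSet H.label)) : H.side (x * u) = H.side x := by
  refine apply_mul_eq_of_mem_specialSubgroup H.side (fun u _ v hv => ?_) hu
  by_contra hne
  exact Γ.ne_of_adj hv (congrArg label (separates_mul_gen_iff.1 (Ne.symm hne))).symm

theorem gen_ne_one (v : V) : gen Γ v ≠ 1 := fun h =>
  Hyperplane.separates_mul_gen_iff.2 (rfl : Edge.dual (⟨1, v⟩ : Edge Γ) = _) (by rw [h, mul_one])

/-! ### The 1-skeleton -/

theorem Edge.ends_eq_iff {e : Edge Γ} {x y : RAAG Γ} : e.ends = s(x, y) ↔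
    x = e.base ∧ y = e.base * gen Γ e.label ∨ y = e.base ∧ x = e.base * gen Γ e.label := by
  rw [ends, eq_comm, Sym2.eq_iff]
  tauto

theorem adj_iff {x y : RAAG Γ} : (oneSkeleton Γ).Adj x y ↔ ∃ e : Edge Γ, e.ends = s(x, y) := by
  rw [oneSkeleton, SimpleGraph.fromEdgeSet_adj]
  refine ⟨fun h => h.1, fun h => ⟨h, ?_⟩⟩
  rintro rfl
  obtain ⟨e, he⟩ := h
  rcases Edge.ends_eq_iff.1 he with ⟨h₁, h₂⟩ | ⟨h₁, h₂⟩ <;>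
    exact gen_ne_one e.label (left_eq_mul.1 (h₁.symm.trans h₂))

theorem adj_mul_gen (g : RAAG Γ) (v : V) : (oneSkeleton Γ).Adj g (g * gen Γ v) :=
  adj_iff.2 ⟨⟨g, v⟩, rfl⟩

theorem Edge.separates_iff {e : Edge Γ} {x y : RAAG Γ} {H : Hyperplane Γ}
    (he : e.ends = s(x, y)) : H.Separates x y ↔ e.dual = H := by
  rcases ends_eq_iff.1 he with ⟨rfl, rfl⟩ | ⟨rfl, rfl⟩
  · exact Hyperplane.separates_mul_gen_iff
  · exact ne_comm.trans Hyperplane.separates_mul_gen_iff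

theorem Edge.dual_separates {e : Edge Γ} {x y : RAAG Γ} (he : e.ends = s(x, y)) :
    e.dual.Separates x y :=
  (separates_iff he).2 rfl

theorem complement_adj_iff {H : Hyperplane Γ} {x y : RAAG Γ} :
    H.complement.Adj x y ↔ (oneSkeleton Γ).Adj x y ∧ H.side x = H.side y := by
  rw [Hyperplane.complement, SimpleGraph.deleteEdges_adj]
  refine and_congr_right fun h => ⟨fun hnot => ?_, ?_⟩
  · by_contra hsep
    obtain ⟨e, he⟩ := adj_iff.1 h
    exact hnot ⟨e, (Edge.separates_iff he).1 hsep, he⟩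
  · rintro hside ⟨e, hdual, he⟩
    exact (Edge.separates_iff he).2 hdual hside

theorem connected_oneSkeleton : (oneSkeleton Γ).Connected := by
  refine ⟨fun x y => ?_⟩
  have h := rel_mul_of_mem_specialSubgroup (oneSkeleton Γ).reachableSetoid (x := x)
    (u := x⁻¹ * y) (fun u _ v _ => (adj_mul_gen (x * u) v).reachable)
    (specialSubgroup_univ ▸ Subgroup.mem_top _)
  rwa [mul_inv_cancel_left] at h

theorem complement_reachable_mul {H : Hyperplane Γ} {x u : RAAG Γ}
    (hu : u ∈ specialSubgroup Γ (Γ.neighborSet H.label)) : H.complement.Reachable x (x * u) := by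
  refine rel_mul_of_mem_specialSubgroup H.complement.reachableSetoid (fun u _ v hv => ?_) hu
  refine (complement_adj_iff.2 ⟨adj_mul_gen _ v, ?_⟩).reachable
  have hgen := gen_mem_specialSubgroup (Γ := Γ) hv
  exact (H.side_mul_of_mem hgen).symm

theorem side_eq_of_complement_reachable {H : Hyperplane Γ} {x y : RAAG Γ}
    (h : H.complement.Reachable x y) : H.side x = H.side y := by
  obtain ⟨p⟩ := h
  induction p with
  | nil => rfl
  | cons hadj _ ih => exact (complement_adj_iff.1 hadj).2.trans ih

theorem complement_reachable_of_dual_eq {e e' : Edge Γ} (h : e.dual = e'.dual) :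
    e.dual.complement.Reachable e.base e'.base ∧
      e.dual.complement.Reachable (e.base * gen Γ e.label) (e'.base * gen Γ e'.label) := by
  obtain ⟨u, hu, rfl⟩ := dual_eq_dual_iff.1 h
  refine ⟨complement_reachable_mul hu, ?_⟩
  rw [mul_assoc e.base u, ← (commute_gen_of_mem_specialSubgroup hu).eq, ← mul_assoc]
  exact complement_reachable_mul hu

theorem complement_reachable_base_or (e : Edge Γ) (x : RAAG Γ) :
    e.dual.complement.Reachable x e.base ∨
      e.dual.complement.Reachable x (e.base * gen Γ e.label) := by
  have hpath := (SimpleGraph.reachable_iff_reflTransGen x e.base).1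
    (connected_oneSkeleton.preconnected x e.base)
  induction hpath using Relation.ReflTransGen.head_induction_on with
  | refl => exact Or.inl (SimpleGraph.Reachable.refl _)
  | @head x y hadj _ ih =>
    by_cases hside : e.dual.side x = e.dual.side y
    · have hxy := (complement_adj_iff.2 ⟨hadj, hside⟩).reachable
      exact ih.imp hxy.trans hxy.trans
    · obtain ⟨e', he'⟩ := adj_iff.1 hadj
      obtain ⟨hbase, hend⟩ :=
        complement_reachable_of_dual_eq ((Edge.separates_iff he').1 hside).symm
      rcases Edge.ends_eq_iff.1 he' with ⟨rfl, -⟩ | ⟨-, rfl⟩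
      · exact Or.inl hbase.symm
      · exact Or.inr hend.symm

theorem complement_reachable_iff {H : Hyperplane Γ} {x y : RAAG Γ} :
    H.complement.Reachable x y ↔ H.side x = H.side y := by
  refine ⟨side_eq_of_complement_reachable, fun h => ?_⟩
  obtain ⟨e, rfl⟩ := Quot.exists_rep H
  have hsep := e.dual_separates rfl
  rcases complement_reachable_base_or e x with hx | hx <;>
    rcases complement_reachable_base_or e y with hy | hy
  · exact hx.trans hy.symm
  · exact absurd ((side_eq_of_complement_reachable hx).symm.trans
      (h.trans (side_eq_of_complement_reachable hy))) hsep
  · exact absurd ((side_eq_of_complement_reachable hy).symm.trans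
      (h.symm.trans (side_eq_of_complement_reachable hx))) hsep
  · exact hx.trans hy.symm

/-! ### Halfspaces -/

/-- The halfspace bounded by `H` that contains the vertex `x`. -/
def halfspaceAt (H : Hyperplane Γ) (x : RAAG Γ) : Halfspace Γ :=
  ⟨H, {y | H.complement.Reachable x y}, x, rfl⟩

theorem mem_halfspaceAt {H : Hyperplane Γ} {x y : RAAG Γ} :
    y ∈ (halfspaceAt H x).carrier ↔ H.side x = H.side y := complement_reachable_iff

theorem self_mem_halfspaceAt (H : Hyperplane Γ) (x : RAAG Γ) : x ∈ (halfspaceAt H x).carrier :=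
  mem_halfspaceAt.2 rfl

theorem eq_halfspaceAt {h : Halfspace Γ} {x : RAAG Γ} (hx : x ∈ h.carrier) :
    h = halfspaceAt h.boundary x := by
  obtain ⟨y, hy⟩ := h.isComponent
  refine Halfspace.ext rfl ?_
  rw [hy] at hx ⊢
  ext z
  exact ⟨fun hz => hx.symm.trans hz, fun hz => hx.trans hz⟩

theorem halfspaceAt_congr {H : Hyperplane Γ} {x y : RAAG Γ} (h : H.side x = H.side y) :
    halfspaceAt H x = halfspaceAt H y :=
  eq_halfspaceAt (h := halfspaceAt H x) (mem_halfspaceAt.2 h)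

theorem Halfspace.nonempty (h : Halfspace Γ) : h.carrier.Nonempty := by
  obtain ⟨x, hx⟩ := h.isComponent
  exact ⟨x, hx ▸ SimpleGraph.Reachable.refl x⟩

theorem Hyperplane.exists_separates (H : Hyperplane Γ) (x : RAAG Γ) : ∃ y, H.Separates x y := by
  obtain ⟨e, rfl⟩ := Quot.exists_rep H
  have hsep := e.dual_separates rfl
  by_contra! hall
  exact hsep ((hall _).symm.trans (hall _))

theorem Halfspace.mem_iff_side_eq {h : Halfspace Γ} {x y : RAAG Γ} (hx : x ∈ h.carrier) :
    y ∈ h.carrier ↔ h.boundary.side x = h.boundary.side y := by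
  rw [eq_halfspaceAt hx]
  exact mem_halfspaceAt

theorem Halfspace.mem_iff_separates {h : Halfspace Γ} {x y : RAAG Γ} (hx : x ∉ h.carrier) :
    y ∈ h.carrier ↔ h.boundary.Separates x y := by
  obtain ⟨z, hz⟩ := h.nonempty
  have hzx : h.boundary.Separates z x := fun hside => hx ((mem_iff_side_eq hz).2 hside)
  rw [mem_iff_side_eq hz]
  exact ⟨fun hzy hxy => hzx (hzy.trans hxy.symm),
    fun hxy => Hyperplane.Separates.side_eq hzx.symm hxy⟩

theorem Halfspace.separates_iff {h : Halfspace Γ} {x y : RAAG Γ} :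
    h.boundary.Separates x y ↔ ¬(x ∈ h.carrier ↔ y ∈ h.carrier) := by
  by_cases hx : x ∈ h.carrier
  · simp only [hx, mem_iff_side_eq hx, true_iff, ne_eq]
  · simp only [hx, mem_iff_separates hx, false_iff, not_not]

theorem Halfspace.exists_notMem (h : Halfspace Γ) : ∃ x, x ∉ h.carrier := by
  obtain ⟨x, hx⟩ := h.nonempty
  obtain ⟨y, hy⟩ := h.boundary.exists_separates x
  exact ⟨y, fun hmem => hy ((mem_iff_side_eq hx).1 hmem)⟩

/-! ### The path metric -/

theorem dist_triangle (x y z : RAAG Γ) : (oneSkeleton Γ).dist x z ≤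
    (oneSkeleton Γ).dist x y + (oneSkeleton Γ).dist y z :=
  connected_oneSkeleton.dist_triangle

theorem dist_mul_left_le (g x y : RAAG Γ) :
    (oneSkeleton Γ).dist (g * x) (g * y) ≤ (oneSkeleton Γ).dist x y := by
  obtain ⟨p, hp⟩ := connected_oneSkeleton.exists_walk_length_eq_dist x y
  let f : oneSkeleton Γ →g oneSkeleton Γ := ⟨fun z => g * z, oneSkeleton_adj_smul g _ _⟩
  exact (SimpleGraph.dist_le (p.map f)).trans_eq ((p.length_map f).trans hp)

theorem dist_mul_left (g x y : RAAG Γ) :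
    (oneSkeleton Γ).dist (g * x) (g * y) = (oneSkeleton Γ).dist x y := by
  refine le_antisymm (dist_mul_left_le g x y) ?_
  simpa only [inv_mul_cancel_left] using dist_mul_left_le g⁻¹ (g * x) (g * y)

theorem dist_eq_of_inv_mul_eq {x y x' y' : RAAG Γ} (h : x⁻¹ * y = x'⁻¹ * y') :
    (oneSkeleton Γ).dist x y = (oneSkeleton Γ).dist x' y' := by
  rw [← dist_mul_left x⁻¹, ← dist_mul_left x'⁻¹ x', h, inv_mul_cancel, inv_mul_cancel]

theorem Edge.dist_eq_one {e : Edge Γ} {x y : RAAG Γ} (he : e.ends = s(x, y)) :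
    (oneSkeleton Γ).dist x y = 1 :=
  SimpleGraph.dist_eq_one_iff_adj.2 (adj_iff.2 ⟨e, he⟩)

theorem exists_edge_dist_eq {x y : RAAG Γ} (h : x ≠ y) : ∃ (z : RAAG Γ) (e : Edge Γ),
    e.ends = s(x, z) ∧ (oneSkeleton Γ).dist x y = (oneSkeleton Γ).dist z y + 1 := by
  obtain ⟨p, hp⟩ := connected_oneSkeleton.exists_walk_length_eq_dist x y
  cases p with
  | nil => exact absurd rfl h
  | @cons _ z _ hz q =>
    obtain ⟨e, he⟩ := adj_iff.1 hz
    refine ⟨z, e, he, le_antisymm ?_ ?_⟩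
    · have htri := dist_triangle x z y
      rwa [e.dist_eq_one he, add_comm] at htri
    · rw [← hp, SimpleGraph.Walk.length_cons]
      exact Nat.succ_le_succ (SimpleGraph.dist_le q)

theorem geodesic_induction {y : RAAG Γ} {p : RAAG Γ → Prop} (refl : p y)
    (step : ∀ (x z : RAAG Γ) (e : Edge Γ), e.ends = s(x, z) →
      (oneSkeleton Γ).dist x y = (oneSkeleton Γ).dist z y + 1 → p z → p x) (x : RAAG Γ) : p x := by
  induction hn : (oneSkeleton Γ).dist x y generalizing x with
  | zero => exact connected_oneSkeleton.dist_eq_zero_iff.1 hn ▸ refl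
  | succ n ih =>
    have hxy : x ≠ y := fun h => by simp [h] at hn
    obtain ⟨z, e, he, hd⟩ := exists_edge_dist_eq hxy
    exact step x z e he hd (ih z (by omega))

theorem inv_mul_eq_of_dual_eq {e e' : Edge Γ} (h : e.dual = e'.dual) {x x' y y' : RAAG Γ}
    (he : e.ends = s(x, x')) (he' : e'.ends = s(y, y')) (hs : e.dual.side x = e.dual.side y) :
    x⁻¹ * y = x'⁻¹ * y' := by
  obtain ⟨u, hu, rfl⟩ := dual_eq_dual_iff.1 h
  have hcomm : e.base * u * gen Γ e.label = e.base * gen Γ e.label * u := by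
    rw [mul_assoc, ← (commute_gen_of_mem_specialSubgroup hu).eq, mul_assoc]
  have hside : ∀ z, e.dual.side (z * u) = e.dual.side z := fun z => e.dual.side_mul_of_mem hu
  have hsep := e.dual_separates he
  rcases Edge.ends_eq_iff.1 he with ⟨rfl, rfl⟩ | ⟨rfl, rfl⟩ <;>
    rcases Edge.ends_eq_iff.1 he' with ⟨rfl, rfl⟩ | ⟨rfl, rfl⟩
  · rw [hcomm, inv_mul_cancel_left, inv_mul_cancel_left]
  · exact absurd (hs.trans (by rw [hcomm, hside])) hsep
  · exact absurd (hs.trans (hside _)) hsep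
  · rw [hcomm, inv_mul_cancel_left, inv_mul_cancel_left]

theorem exists_edge_dual_eq_dist_le {H : Hyperplane Γ} {x y : RAAG Γ} (h : H.Separates x y) :
    ∃ (p q : RAAG Γ) (e : Edge Γ), e.ends = s(p, q) ∧ e.dual = H ∧ H.side p = H.side x ∧
      (oneSkeleton Γ).dist x p + 1 + (oneSkeleton Γ).dist q y ≤ (oneSkeleton Γ).dist x y := by
  induction x using geodesic_induction (y := y) with
  | refl => exact absurd rfl h
  | step x z e he hd ih =>
    by_cases hs : H.side x = H.side z
    · obtain ⟨p, q, e', he', hH, hp, hle⟩ := ih fun hzy => h (hs.trans hzy)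
      refine ⟨p, q, e', he', hH, hp.trans hs.symm, ?_⟩
      have htri := dist_triangle x z p
      rw [e.dist_eq_one he] at htri
      omega
    · refine ⟨x, z, e, he, (Edge.separates_iff he).1 hs, rfl, ?_⟩
      rw [SimpleGraph.dist_self]
      omega

theorem dist_lt_of_separates {e : Edge Γ} {x z y : RAAG Γ} (he : e.ends = s(x, z))
    (h : e.dual.Separates x y) : (oneSkeleton Γ).dist z y < (oneSkeleton Γ).dist x y := by
  obtain ⟨p, q, e', he', hd, hp, hle⟩ := exists_edge_dual_eq_dist_le h
  have hpar := dist_eq_of_inv_mul_eq (inv_mul_eq_of_dual_eq hd.symm he he' hp.symm)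
  have htri := dist_triangle z q y
  omega

theorem separates_of_dist_lt {e : Edge Γ} {x z y : RAAG Γ} (he : e.ends = s(x, z))
    (h : (oneSkeleton Γ).dist z y < (oneSkeleton Γ).dist x y) : e.dual.Separates x y := by
  intro hxy
  have hxz := e.dual_separates he
  have hlt := dist_lt_of_separates (he.trans Sym2.eq_swap) (y := y)
    fun hzy => hxz (hxy.trans hzy.symm)
  omega

theorem finite_separates (x y : RAAG Γ) : {H : Hyperplane Γ | H.Separates x y}.Finite := by
  induction x using geodesic_induction (y := y) with
  | refl => exact Set.finite_empty.subset fun H hH => hH rfl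
  | step x z e he _ ih =>
    refine (ih.insert e.dual).subset fun H hH => ?_
    by_cases hs : H.side x = H.side z
    · exact Or.inr fun hzy => hH (hs.trans hzy)
    · exact Or.inl ((Edge.separates_iff he).1 hs).symm

theorem Edge.inv_mul_mem_specialSubgroup {e : Edge Γ} {x y : RAAG Γ} (he : e.ends = s(x, y))
    {Λ : Set V} (h : e.label ∈ Λ) : x⁻¹ * y ∈ specialSubgroup Γ Λ := by
  have hgen := gen_mem_specialSubgroup (Γ := Γ) h
  rcases ends_eq_iff.1 he with ⟨rfl, rfl⟩ | ⟨rfl, rfl⟩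
  · rwa [inv_mul_cancel_left]
  · rw [mul_inv_rev, inv_mul_cancel_right]
    exact inv_mem hgen

theorem inv_mul_mem_specialSubgroup_of_label_mem {Λ : Set V} {x y : RAAG Γ}
    (h : ∀ H : Hyperplane Γ, H.Separates x y → H.label ∈ Λ) : x⁻¹ * y ∈ specialSubgroup Γ Λ := by
  induction x using geodesic_induction (y := y) with
  | refl => rw [inv_mul_cancel]; exact one_mem _
  | step x z e he hd ih =>
    have hlabel : e.label ∈ Λ := h e.dual (separates_of_dist_lt he (by omega))
    have hzy : z⁻¹ * y ∈ specialSubgroup Γ Λ := by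
      refine ih fun H hH => ?_
      by_cases hs : H.side x = H.side z
      · exact h H fun hxy => hH (hs.symm.trans hxy)
      · rwa [← (Edge.separates_iff he).1 hs]
    have hxy := mul_mem (e.inv_mul_mem_specialSubgroup he hlabel) hzy
    rwa [mul_assoc, mul_inv_cancel_left] at hxy

theorem Edge.conj_gen_eq_of_dual_eq {e e' : Edge Γ} (h : e.dual = e'.dual) :
    e.base * gen Γ e.label * e.base⁻¹ = e'.base * gen Γ e'.label * e'.base⁻¹ := by
  obtain ⟨u, hu, rfl⟩ := dual_eq_dual_iff.1 h
  rw [mul_assoc e.base u, ← (commute_gen_of_mem_specialSubgroup hu).eq, mul_inv_rev, ← mul_assoc,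
    ← mul_assoc, mul_inv_cancel_right]

theorem conj_mem_specialSubgroup_of_dual_eq {Λ : Set V} {y u p q : RAAG Γ} {w : V} {e : Edge Γ}
    (hu : u ∈ specialSubgroup Γ Λ) (hw : w ∈ Λ) (hd : e.dual = Edge.dual ⟨y * u, w⟩)
    (he : e.ends = s(p, q)) : y⁻¹ * (p * q⁻¹ * y) ∈ specialSubgroup Γ Λ := by
  have hconj : y⁻¹ * (e.base * gen Γ e.label * e.base⁻¹ * y) = u * gen Γ w * u⁻¹ := by
    rw [Edge.conj_gen_eq_of_dual_eq hd]
    group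
  have hmem : u * gen Γ w * u⁻¹ ∈ specialSubgroup Γ Λ :=
    mul_mem (mul_mem hu (gen_mem_specialSubgroup hw)) (inv_mem hu)
  rcases Edge.ends_eq_iff.1 he with ⟨rfl, rfl⟩ | ⟨rfl, rfl⟩
  · have hinv : y⁻¹ * (e.base * (e.base * gen Γ e.label)⁻¹ * y) = (u * gen Γ w * u⁻¹)⁻¹ := by
      rw [← hconj]
      group
    exact hinv ▸ inv_mem hmem
  · exact hconj ▸ hmem

theorem side_eq_of_forall_dist_le {Λ : Set V} {x y : RAAG Γ}
    (hy : ∀ u ∈ specialSubgroup Γ Λ, (oneSkeleton Γ).dist x y ≤ (oneSkeleton Γ).dist x (y * u))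
    {u : RAAG Γ} (hu : u ∈ specialSubgroup Γ Λ) {w : V} (hw : w ∈ Λ) :
    (Edge.dual ⟨y * u, w⟩).side x = (Edge.dual ⟨y * u, w⟩).side y := by
  by_contra hsep
  obtain ⟨p, q, e, he, hd, -, hle⟩ := exists_edge_dual_eq_dist_le hsep
  -- Translating the part of the geodesic after the edge from `p` to `q` by `p * q⁻¹` removes this
  -- edge, and moves `y` to a vertex of the same coset.
  have hmin := hy _ (conj_mem_specialSubgroup_of_dual_eq hu hw hd he)
  rw [mul_inv_cancel_left] at hmin
  have htail : (oneSkeleton Γ).dist p (p * q⁻¹ * y) = (oneSkeleton Γ).dist q y :=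
    dist_eq_of_inv_mul_eq (by rw [mul_assoc, inv_mul_cancel_left])
  have htri := dist_triangle x p (p * q⁻¹ * y)
  omega

/-! ### Crossing hyperplanes -/

/-- Two hyperplanes cross if each side of the one meets each side of the other. -/
def Hyperplane.Crosses (H K : Hyperplane Γ) : Prop :=
  ∀ a b : ZMod 2, ∃ x, H.side x = a ∧ K.side x = b

theorem Hyperplane.Crosses.symm {H K : Hyperplane Γ} (h : H.Crosses K) : K.Crosses H :=
  fun a b => (h b a).imp fun _ => And.symm

theorem crosses_of_quadrants {H K : Hyperplane Γ} {x y z t : RAAG Γ}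
    (hxy : H.side x = H.side y) (hzt : H.side z = H.side t) (hxz : H.Separates x z)
    (hxy' : K.Separates x y) (hzt' : K.Separates z t) : H.Crosses K := by
  have cover : ∀ a b c : ZMod 2, a ≠ b → c = a ∨ c = b := by decide
  intro a b
  rcases cover _ _ a hxz with rfl | rfl
  · rcases cover _ _ b hxy' with rfl | rfl
    · exact ⟨x, rfl, rfl⟩
    · exact ⟨y, hxy.symm, rfl⟩
  · rcases cover _ _ b hzt' with rfl | rfl
    · exact ⟨z, rfl, rfl⟩
    · exact ⟨t, hzt.symm, rfl⟩

theorem exists_edge_dual_eq_side_eq {H K : Hyperplane Γ} {p q : RAAG Γ} (hH : H.Separates p q)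
    (hK : K.side p = K.side q) : ∃ (x y : RAAG Γ) (e : Edge Γ),
      e.ends = s(x, y) ∧ e.dual = H ∧ K.side x = K.side p ∧ K.side y = K.side p := by
  obtain ⟨P⟩ := complement_reachable_iff.2 hK
  induction P with
  | nil => exact absurd rfl hH
  | @cons p p' q hadj _ ih =>
    obtain ⟨hadj', hK'⟩ := complement_adj_iff.1 hadj
    by_cases hp : H.side p = H.side p'
    · obtain ⟨x, y, e, he, hd, hx, hy⟩ := ih (fun h => hH (hp.trans h)) (hK'.symm.trans hK)
      exact ⟨x, y, e, he, hd, hx.trans hK'.symm, hy.trans hK'.symm⟩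
    · obtain ⟨e, he⟩ := adj_iff.1 hadj'
      exact ⟨p, p', e, he, (Edge.separates_iff he).1 hp, rfl, hK'.symm⟩

theorem Hyperplane.Crosses.exists_dual {e : Edge Γ} {K : Hyperplane Γ} (h : e.dual.Crosses K) :
    ∃ u ∈ specialSubgroup Γ (Γ.neighborSet e.label), ∃ w, Γ.Adj e.label w ∧
      Edge.dual ⟨e.base * u, w⟩ = K := by
  by_contra! hno
  obtain ⟨p, hp, hpK⟩ := h 0 (K.side e.base + 1)
  obtain ⟨q, hq, hqK⟩ := h 1 (K.side e.base + 1)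
  have hpq : e.dual.Separates p q := fun hside => zero_ne_one (hp.symm.trans (hside.trans hq))
  obtain ⟨x, y, e', he', hd, hx, hy⟩ := exists_edge_dual_eq_side_eq hpq (hpK.trans hqK.symm)
  obtain ⟨u, hu, rfl⟩ := dual_eq_dual_iff.1 hd.symm
  have hbase : K.side (e.base * u) = K.side e.base := by
    refine apply_mul_eq_of_mem_specialSubgroup K.side (fun u hu w hw => ?_) hu
    by_contra hne
    exact hno u hu w hw (separates_mul_gen_iff.1 (Ne.symm hne))
  have hne : K.side (e.base * u) ≠ K.side e.base + 1 := by simp [hbase]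
  rcases Edge.ends_eq_iff.1 he' with ⟨rfl, -⟩ | ⟨rfl, -⟩
  · exact hne (hx.trans hpK)
  · exact hne (hy.trans hpK)

theorem Hyperplane.Crosses.adj_label {H K : Hyperplane Γ} (h : H.Crosses K) :
    Γ.Adj H.label K.label := by
  obtain ⟨e, rfl⟩ := Quot.exists_rep H
  obtain ⟨u, -, w, hw, rfl⟩ := Hyperplane.Crosses.exists_dual (e := e) h
  exact hw

theorem Hyperplane.Crosses.meets {H K : Hyperplane Γ} (h : H.Crosses K) : H.Meets K := by
  obtain ⟨e, rfl⟩ := Quot.exists_rep H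
  obtain ⟨u, hu, w, hw, rfl⟩ := Hyperplane.Crosses.exists_dual (e := e) h
  exact Or.inr ⟨e.base * u, e.label, w, hw, (dual_eq_dual_iff.2 ⟨u, hu, rfl⟩).symm, rfl⟩

theorem Hyperplane.Meets.eq_or_crosses {H K : Hyperplane Γ} (h : H.Meets K) :
    H = K ∨ H.Crosses K := by
  refine h.imp_right ?_
  rintro ⟨g, v, w, hvw, rfl, rfl⟩
  have hv : ∀ x, (Edge.dual ⟨g, v⟩).side (x * gen Γ w) = (Edge.dual ⟨g, v⟩).side x :=
    fun x => side_mul_of_mem (gen_mem_specialSubgroup hvw)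
  have hw : ∀ x, (Edge.dual ⟨g, w⟩).side (x * gen Γ v) = (Edge.dual ⟨g, w⟩).side x :=
    fun x => side_mul_of_mem (gen_mem_specialSubgroup hvw.symm)
  have hcomm : g * gen Γ v * gen Γ w = g * gen Γ w * gen Γ v := by
    rw [mul_assoc, (commute_gen hvw).eq, mul_assoc]
  refine crosses_of_quadrants (x := g) (y := g * gen Γ w) (z := g * gen Γ v)
    (t := g * gen Γ v * gen Γ w) (hv g).symm (hv _).symm (separates_mul_gen_iff.2 rfl)
    (separates_mul_gen_iff.2 rfl) ?_
  rw [Separates, hcomm, hw, hw]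
  exact separates_mul_gen_iff.2 rfl

/-! ### Nested halfspaces -/

theorem boundary_eq_of_carrier_eq {h k : Halfspace Γ} (hk : h.carrier = k.carrier) :
    h.boundary = k.boundary := by
  obtain ⟨e, he⟩ := Quot.exists_rep h.boundary
  have hsep : h.boundary.Separates e.base (e.base * gen Γ e.label) := he ▸ e.dual_separates rfl
  rw [Halfspace.separates_iff, hk, ← Halfspace.separates_iff] at hsep
  exact he.symm.trans ((Edge.separates_iff rfl).1 hsep)

theorem subset_or_subset_of_not_crosses {h k : Halfspace Γ}
    (hcross : ¬ h.boundary.Crosses k.boundary) (hne : (h.carrier ∩ k.carrier).Nonempty) :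
    k.carrier ⊆ h.carrier ∨ h.carrier ⊆ k.carrier ∨ h.carrierᶜ ⊆ k.carrier := by
  by_contra! hno
  obtain ⟨⟨y, hyk, hyh⟩, ⟨z, hzh, hzk⟩, ⟨t, hth, htk⟩⟩ := by
    simpa only [Set.not_subset] using hno
  obtain ⟨x, hxh, hxk⟩ := hne
  rw [Set.mem_compl_iff] at hth
  refine hcross (crosses_of_quadrants (x := x) (y := z) (z := y) (t := t) ?_ ?_ ?_ ?_ ?_)
  · exact (Halfspace.mem_iff_side_eq hxh).1 hzh
  · exact not_not.1 fun hsep => hth ((Halfspace.mem_iff_separates hyh).2 hsep)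
  · exact Halfspace.separates_iff.2 (by tauto)
  · exact Halfspace.separates_iff.2 (by tauto)
  · exact Halfspace.separates_iff.2 (by tauto)

theorem not_crosses_of_subset {h k : Halfspace Γ} (hk : k.carrier ⊆ h.carrier) :
    ¬ k.boundary.Crosses h.boundary := by
  intro hc
  obtain ⟨x, hx⟩ := k.nonempty
  obtain ⟨y, hy⟩ := h.exists_notMem
  obtain ⟨z, hzk, hzh⟩ := hc (k.boundary.side x) (h.boundary.side y)
  have hz := hk ((Halfspace.mem_iff_side_eq hx).2 hzk.symm)
  exact hy ((Halfspace.mem_iff_side_eq hz).2 hzh)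

theorem eq_of_subset_of_boundary_eq {h k : Halfspace Γ} (hk : k.carrier ⊆ h.carrier)
    (hb : k.boundary = h.boundary) : k = h := by
  obtain ⟨x, hx⟩ := k.nonempty
  rw [eq_halfspaceAt hx, eq_halfspaceAt (hk hx), hb]

theorem Hyperplane.Crosses.exists_mem {L : Hyperplane Γ} {h : Halfspace Γ}
    (hL : L.Crosses h.boundary) (a : ZMod 2) : ∃ x ∈ h.carrier, L.side x = a := by
  obtain ⟨y, hy⟩ := h.nonempty
  obtain ⟨x, hxL, hxh⟩ := hL a (h.boundary.side y)
  exact ⟨x, (Halfspace.mem_iff_side_eq hy).2 hxh.symm, hxL⟩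

theorem Hyperplane.Crosses.exists_notMem {L : Hyperplane Γ} {h : Halfspace Γ}
    (hL : L.Crosses h.boundary) (a : ZMod 2) : ∃ x ∉ h.carrier, L.side x = a := by
  obtain ⟨y, hy⟩ := h.exists_notMem
  obtain ⟨x, hxL, hxh⟩ := hL a (h.boundary.side y)
  exact ⟨x, fun hx => hy ((Halfspace.mem_iff_side_eq hx).2 hxh), hxL⟩

theorem crosses_of_subset {h k l : Halfspace Γ} (hkl : k.carrier ⊆ l.carrier)
    (hlh : l.carrier ⊆ h.carrier) {L : Hyperplane Γ} (hk : L.Crosses k.boundary)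
    (hh : L.Crosses h.boundary) : L.Crosses l.boundary := by
  obtain ⟨x, hx, hx₀⟩ := hk.exists_mem 0
  obtain ⟨y, hy, hy₀⟩ := hh.exists_notMem 0
  obtain ⟨z, hz, hz₁⟩ := hk.exists_mem 1
  obtain ⟨t, ht, ht₁⟩ := hh.exists_notMem 1
  have hsep : ∀ {p q}, p ∈ k.carrier → q ∉ h.carrier → l.boundary.Separates p q :=
    fun hp hq => Halfspace.separates_iff.2 fun hiff => hq (hlh (hiff.1 (hkl hp)))
  refine crosses_of_quadrants (hx₀.trans hy₀.symm) (hz₁.trans ht₁.symm) ?_ (hsep hx hy) (hsep hz ht)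
  rw [Hyperplane.Separates, hx₀, hz₁]
  exact zero_ne_one

theorem meets_of_subset {h k l : Halfspace Γ} (hkl : k.carrier ⊆ l.carrier)
    (hlh : l.carrier ⊆ h.carrier) {L : Hyperplane Γ} (hk : L.Meets k.boundary)
    (hh : L.Meets h.boundary) : L.Meets l.boundary := by
  have hkh := hkl.trans hlh
  rcases hk.eq_or_crosses with rfl | hk <;> rcases hh.eq_or_crosses with heq | hh
  · have hcarrier : h.carrier ⊆ k.carrier := (eq_of_subset_of_boundary_eq hkh heq) ▸ subset_rfl
    exact Or.inl (boundary_eq_of_carrier_eq (hkl.antisymm (hlh.trans hcarrier)))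
  · exact absurd hh (not_crosses_of_subset hkh)
  · exact absurd (heq ▸ hk.symm) (not_crosses_of_subset hkh)
  · exact (crosses_of_subset hkl hlh hk hh).meets

theorem stronglySeparated_of_subset {h k : Halfspace Γ} (hkh : k.carrier ⊆ h.carrier)
    (hne : k.boundary ≠ h.boundary)
    (hno : ∀ L : Hyperplane Γ, L.Crosses k.boundary → ¬ L.Crosses h.boundary) :
    StronglySeparated k.boundary h.boundary := by
  rintro ⟨L, hk, hh⟩
  rcases hk.eq_or_crosses with rfl | hk <;> rcases hh.eq_or_crosses with heq | hh
  · exact hne heq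
  · exact not_crosses_of_subset hkh hh
  · exact not_crosses_of_subset hkh (heq ▸ hk.symm)
  · exact hno L hk hh

/-! ### Points of the Roller boundary -/

theorem exists_vertex_agreeing (ξ : RollerBoundary Γ) {F : Set (Halfspace Γ)} (hF : F.Finite) :
    ∃ z, ∀ h ∈ F, h ∈ ξ.halfspaces ↔ z ∈ h.carrier := by
  have hopen : IsOpen (F.pi fun h => {ξ.1 h}) :=
    isOpen_set_pi hF fun h _ => isOpen_discrete _
  obtain ⟨_, hη, z, rfl⟩ := mem_closure_iff.1 ξ.2.1 _ hopen fun h _ => rfl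
  refine ⟨z, fun h hh => ?_⟩
  have hz : vertexEmbedding Γ z h = ξ.1 h := hη h hh
  change ξ.1 h = true ↔ _
  rw [← hz]
  simp only [vertexEmbedding, decide_eq_true_eq]

theorem exists_mem_inter {ξ : RollerBoundary Γ} {h k : Halfspace Γ} (hh : h ∈ ξ.halfspaces)
    (hk : k ∈ ξ.halfspaces) : (h.carrier ∩ k.carrier).Nonempty := by
  obtain ⟨z, hz⟩ := exists_vertex_agreeing ξ (Set.toFinite {h, k})
  exact ⟨z, (hz h (by simp)).1 hh, (hz k (by simp)).1 hk⟩

theorem mem_halfspaces_of_subset {ξ : RollerBoundary Γ} {h k : Halfspace Γ}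
    (hh : h ∈ ξ.halfspaces) (hk : h.carrier ⊆ k.carrier) : k ∈ ξ.halfspaces := by
  obtain ⟨z, hz⟩ := exists_vertex_agreeing ξ (Set.toFinite {h, k})
  exact (hz k (by simp)).2 (hk ((hz h (by simp)).1 hh))

theorem halfspaceAt_mem_iff (ξ : RollerBoundary Γ) {H : Hyperplane Γ} {x y : RAAG Γ}
    (hxy : H.Separates x y) :
    halfspaceAt H x ∈ ξ.halfspaces ↔ halfspaceAt H y ∉ ξ.halfspaces := by
  obtain ⟨z, hz⟩ := exists_vertex_agreeing ξ
    (Set.toFinite {halfspaceAt H x, halfspaceAt H y})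
  rw [hz _ (by simp), hz _ (by simp), mem_halfspaceAt, mem_halfspaceAt]
  exact ⟨fun hxz hyz => hxy (hxz.trans hyz.symm),
    fun hyz => not_not.1 fun hxz => hyz (hxy.side_eq hxz)⟩

theorem mem_halfspaces_iff_mem {ξ : RollerBoundary Γ} {h : Halfspace Γ} {x : RAAG Γ}
    (hx : halfspaceAt h.boundary x ∈ ξ.halfspaces) : h ∈ ξ.halfspaces ↔ x ∈ h.carrier := by
  refine ⟨fun hh => ?_, fun hxh => eq_halfspaceAt hxh ▸ hx⟩
  obtain ⟨y, hy⟩ := h.nonempty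
  by_contra hxh
  have hsep : h.boundary.Separates y x := Halfspace.separates_iff.2 (by tauto)
  rw [eq_halfspaceAt hy, halfspaceAt_mem_iff ξ hsep] at hh
  exact hh hx

theorem exists_mem_halfspaces_notMem (ξ : RollerBoundary Γ) (x : RAAG Γ) :
    ∃ h ∈ ξ.halfspaces, x ∉ h.carrier := by
  by_contra! hall
  have hmem : ∀ H : Hyperplane Γ, halfspaceAt H x ∈ ξ.halfspaces := fun H => by
    obtain ⟨y, hy⟩ := H.exists_separates x
    rw [halfspaceAt_mem_iff ξ hy]
    exact fun hyξ => hy (mem_halfspaceAt.1 (hall _ hyξ)).symm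
  refine ξ.2.2 ⟨x, funext fun h => Bool.eq_iff_iff.2 ?_⟩
  simp only [vertexEmbedding, decide_eq_true_eq]
  exact (mem_halfspaces_iff_mem (hmem h.boundary)).symm

/-! ### Geodesic rays -/

section Ray

variable {r : ℕ → RAAG Γ} {ξ : RollerBoundary Γ}

theorem IsGeodesicRay.dist_eq (hr : IsGeodesicRay Γ r) {m n : ℕ} (hmn : m ≤ n) :
    (oneSkeleton Γ).dist (r m) (r n) = n - m := by
  simpa only [Nat.add_sub_cancel' hmn] using hr m (n - m)

theorem IsGeodesicRay.exists_ends_eq (hr : IsGeodesicRay Γ r) (n : ℕ) :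
    ∃ e : Edge Γ, e.ends = s(r n, r (n + 1)) :=
  adj_iff.1 (SimpleGraph.dist_eq_one_iff_adj.1 (hr n 1))

/-- The `n`-th edge of a geodesic ray, joining its `n`-th and `n + 1`-st vertices. -/
noncomputable def IsGeodesicRay.edge (hr : IsGeodesicRay Γ r) (n : ℕ) : Edge Γ :=
  (hr.exists_ends_eq n).choose

theorem IsGeodesicRay.ends_edge (hr : IsGeodesicRay Γ r) (n : ℕ) :
    (hr.edge n).ends = s(r n, r (n + 1)) :=
  (hr.exists_ends_eq n).choose_spec

theorem IsGeodesicRay.exists_edge_dual_eq (hr : IsGeodesicRay Γ r) {K : Hyperplane Γ} {m n : ℕ}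
    (hmn : m ≤ n) (h : K.Separates (r m) (r n)) :
    ∃ i, m ≤ i ∧ i < n ∧ (hr.edge i).dual = K := by
  by_contra! hno
  refine h ?_
  induction n, hmn using Nat.le_induction with
  | base => rfl
  | succ n hmn ih =>
    by_cases hs : K.side (r m) = K.side (r n)
    · exact hs.trans (not_not.1 fun hsep =>
        hno n hmn n.lt_succ_self ((Edge.separates_iff (hr.ends_edge n)).1 hsep))
    · exact absurd (ih hs fun i hi hin => hno i hi (hin.trans n.lt_succ_self)) hs

theorem IsGeodesicRay.edge_dual_separates (hr : IsGeodesicRay Γ r) {i j : ℕ} (hij : i < j) :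
    (hr.edge i).dual.Separates (r i) (r j) := by
  refine separates_of_dist_lt (hr.ends_edge i) ?_
  rw [hr.dist_eq hij, hr.dist_eq hij.le]
  omega

theorem IsGeodesicRay.side_eq (hr : IsGeodesicRay Γ r) {K : Hyperplane Γ} {m n k : ℕ}
    (hmn : m ≤ n) (hnk : n ≤ k) (h : K.Separates (r m) (r n)) : K.side (r n) = K.side (r k) := by
  obtain ⟨i, -, hi, rfl⟩ := hr.exists_edge_dual_eq hmn h
  exact (hr.edge_dual_separates hi).side_eq (hr.edge_dual_separates (hi.trans_le hnk))

theorem Represents.halfspaceAt_mem (hξ : Represents r ξ) (hr : IsGeodesicRay Γ r)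
    {K : Hyperplane Γ} {m n : ℕ} (hmn : m ≤ n) (h : K.Separates (r m) (r n)) :
    halfspaceAt K (r n) ∈ ξ.halfspaces :=
  (hξ _).2 ⟨n, fun _ hk => mem_halfspaceAt.2 (hr.side_eq hmn hk h)⟩

theorem isGeodesicRay_of_separates (h : ∀ n, ∃ e : Edge Γ, e.ends = s(r n, r (n + 1)) ∧
    ∀ m > n, e.dual.Separates (r n) (r m)) : IsGeodesicRay Γ r := by
  intro m n
  induction n generalizing m with
  | zero => exact SimpleGraph.dist_self
  | succ n ih =>
    obtain ⟨e, he, hsep⟩ := h m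
    have hlt := dist_lt_of_separates he (hsep (m + (n + 1)) (by omega))
    have htri := dist_triangle (r m) (r (m + 1)) (r (m + (n + 1)))
    rw [Edge.dist_eq_one he] at htri
    have hrest := ih (m + 1)
    rw [add_right_comm, add_assoc] at hrest
    omega

end Ray

/-! ### Rays towards a boundary point -/

theorem exists_ends_eq_notMem_of_nearest {h : Halfspace Γ} {x y : RAAG Γ} (hx : x ∉ h.carrier)
    (hyh : y ∈ h.carrier)
    (hy : ∀ z ∈ h.carrier, (oneSkeleton Γ).dist x y ≤ (oneSkeleton Γ).dist x z) :
    ∃ (z : RAAG Γ) (e : Edge Γ), e.ends = s(y, z) ∧ z ∉ h.carrier := by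
  obtain ⟨z, e, he, hd⟩ := exists_edge_dist_eq (x := y) (y := x) (fun heq => hx (heq ▸ hyh))
  refine ⟨z, e, he, fun hz => ?_⟩
  have hle := hy z hz
  rw [SimpleGraph.dist_comm, hd, SimpleGraph.dist_comm] at hle
  omega

/- The edge that leaves the halfspace at `y` has a whole coset of parallels whose endpoints lie in
the halfspace, and `y` is nearest to `x` in this coset. -/
theorem Hyperplane.Crosses.side_eq_of_nearest {h : Halfspace Γ} {K : Hyperplane Γ}
    (hK : h.boundary.Crosses K) {x y : RAAG Γ} (hx : x ∉ h.carrier) (hyh : y ∈ h.carrier)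
    (hy : ∀ z ∈ h.carrier, (oneSkeleton Γ).dist x y ≤ (oneSkeleton Γ).dist x z) :
    K.side x = K.side y := by
  obtain ⟨z, e, he, hz⟩ := exists_ends_eq_notMem_of_nearest hx hyh hy
  have hdual : e.dual = h.boundary :=
    (Edge.separates_iff he).1 (Halfspace.separates_iff.2 (by tauto))
  obtain ⟨u, hu, w, hw, hKd⟩ := Hyperplane.Crosses.exists_dual (hdual ▸ hK)
  have hcoset : ∀ u ∈ specialSubgroup Γ (Γ.neighborSet e.label),
      (oneSkeleton Γ).dist x y ≤ (oneSkeleton Γ).dist x (y * u) := fun u hu =>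
    hy _ ((Halfspace.mem_iff_side_eq hyh).2
      (Hyperplane.side_mul_of_mem (by rwa [← hdual, label_dual])).symm)
  have hKd' : Edge.dual ⟨y * u, w⟩ = K := by
    rcases Edge.ends_eq_iff.1 he with ⟨rfl, -⟩ | ⟨-, rfl⟩
    · exact hKd
    · rw [mul_assoc, (commute_gen_of_mem_specialSubgroup hu).eq, ← mul_assoc,
        dual_mul_gen hw.symm, hKd]
  exact hKd' ▸ side_eq_of_forall_dist_le hcoset hu hw

theorem subset_halfspaceAt_of_nearest {h : Halfspace Γ} {x y : RAAG Γ} (hx : x ∉ h.carrier)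
    (hyh : y ∈ h.carrier)
    (hy : ∀ z ∈ h.carrier, (oneSkeleton Γ).dist x y ≤ (oneSkeleton Γ).dist x z)
    {K : Hyperplane Γ} (hK : K.Separates x y) : h.carrier ⊆ (halfspaceAt K y).carrier := by
  have hncross : ¬ h.boundary.Crosses (halfspaceAt K y).boundary :=
    fun hc => hK (hc.side_eq_of_nearest hx hyh hy)
  have hxK : x ∉ (halfspaceAt K y).carrier := fun h' => hK (mem_halfspaceAt.1 h').symm
  have hyK : y ∈ (halfspaceAt K y).carrier := self_mem_halfspaceAt K y
  rcases subset_or_subset_of_not_crosses hncross ⟨y, hyh, hyK⟩ with hsub | hsub | hsub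
  · obtain ⟨z, e, he, hz⟩ := exists_ends_eq_notMem_of_nearest hx hyh hy
    have hb : h.boundary = K := by
      rw [← (Edge.separates_iff he).1 (Halfspace.separates_iff.2 (by tauto))]
      exact (Edge.separates_iff he).1 (Halfspace.separates_iff (h := halfspaceAt K y).2
        fun hiff => hz (hsub (hiff.1 hyK)))
    rw [eq_of_subset_of_boundary_eq hsub hb.symm]
  · exact hsub
  · exact absurd (hsub hx) hxK

/-- The distance from a vertex to a halfspace in the 1-skeleton. -/
noncomputable def Halfspace.distTo (h : Halfspace Γ) (x : RAAG Γ) : ℕ :=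
  sInf ((oneSkeleton Γ).dist x '' h.carrier)

theorem exists_step_towards {ξ : RollerBoundary Γ} {h : Halfspace Γ} (hh : h ∈ ξ.halfspaces)
    {x : RAAG Γ} (hx : x ∉ h.carrier) : ∃ (z : RAAG Γ) (e : Edge Γ), e.ends = s(x, z) ∧
      halfspaceAt e.dual z ∈ ξ.halfspaces ∧ h.distTo z < h.distTo x := by
  obtain ⟨y, hyh, hy⟩ : h.distTo x ∈ (oneSkeleton Γ).dist x '' h.carrier :=
    Nat.sInf_mem (h.nonempty.image _)
  have hnear : ∀ z ∈ h.carrier, (oneSkeleton Γ).dist x y ≤ (oneSkeleton Γ).dist x z :=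
    fun z hz => hy.trans_le (Nat.sInf_le ⟨z, hz, rfl⟩)
  obtain ⟨z, e, he, hd⟩ := exists_edge_dist_eq (x := x) (y := y) fun heq => hx (heq ▸ hyh)
  have hsep : e.dual.Separates x y := separates_of_dist_lt he (by omega)
  refine ⟨z, e, he, ?_, ?_⟩
  · rw [halfspaceAt_congr ((Edge.dual_separates he).side_eq hsep)]
    exact mem_halfspaces_of_subset hh (subset_halfspaceAt_of_nearest hx hyh hnear hsep)
  · have hle : h.distTo z ≤ (oneSkeleton Γ).dist z y := Nat.sInf_le ⟨y, hyh, rfl⟩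
    omega

/-- The path of the 1-skeleton with vertices `r` heads for `ξ`: each of its edges enters a
halfspace selected by `ξ`. -/
def HeadsFor (r : ℕ → RAAG Γ) (ξ : RollerBoundary Γ) : Prop :=
  ∀ n, ∃ e : Edge Γ, e.ends = s(r n, r (n + 1)) ∧ halfspaceAt e.dual (r (n + 1)) ∈ ξ.halfspaces

section HeadsFor

variable {r : ℕ → RAAG Γ} {ξ : RollerBoundary Γ}

theorem HeadsFor.mem_of_le (hr : HeadsFor r ξ) {h : Halfspace Γ} (hh : h ∈ ξ.halfspaces)
    {m n : ℕ} (hmn : m ≤ n) (hm : r m ∈ h.carrier) : r n ∈ h.carrier := by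
  induction n, hmn using Nat.le_induction with
  | base => exact hm
  | succ n _ ih =>
    obtain ⟨e, he, heξ⟩ := hr n
    by_contra hn
    have hsep : h.boundary.Separates (r n) (r (n + 1)) := Halfspace.separates_iff.2 (by tauto)
    rw [(Edge.separates_iff he).1 hsep] at heξ
    exact hn ((mem_halfspaces_iff_mem heξ).1 hh)

theorem HeadsFor.isGeodesicRay (hr : HeadsFor r ξ) : IsGeodesicRay Γ r := by
  refine isGeodesicRay_of_separates fun n => ?_
  obtain ⟨e, he, heξ⟩ := hr n
  refine ⟨e, he, fun m hm hs => Edge.dual_separates he (hs.trans ?_)⟩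
  exact (mem_halfspaceAt.1 (hr.mem_of_le heξ hm (self_mem_halfspaceAt _ _))).symm

theorem HeadsFor.represents (hr : HeadsFor r ξ)
    (hreach : ∀ h ∈ ξ.halfspaces, ∃ n, r n ∈ h.carrier) : Represents r ξ := by
  refine fun h => ⟨fun hh => ?_, fun ⟨N, hN⟩ => ?_⟩
  · obtain ⟨N, hN⟩ := hreach h hh
    exact ⟨N, fun n hn => hr.mem_of_le hh hn hN⟩
  · by_contra hh
    obtain ⟨y, hy⟩ := h.exists_notMem
    have hyξ : halfspaceAt h.boundary y ∈ ξ.halfspaces := by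
      have hsep : h.boundary.Separates y (r N) :=
        Halfspace.separates_iff.2 fun hiff => hy (hiff.2 (hN N le_rfl))
      rw [halfspaceAt_mem_iff ξ hsep]
      exact fun hrN => hh ((mem_halfspaces_iff_mem hrN).2 (hN N le_rfl))
    obtain ⟨n, hn⟩ := hreach _ hyξ
    have hmax := hr.mem_of_le hyξ (le_max_right N n) hn
    exact hy ((Halfspace.mem_iff_side_eq (hN _ (le_max_left N n))).2 (mem_halfspaceAt.1 hmax).symm)

end HeadsFor

theorem exists_headsFor_greedy (ξ : RollerBoundary Γ) (idx : Halfspace Γ → ℕ) :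
    ∃ (r : ℕ → RAAG Γ) (target : ℕ → Halfspace Γ), HeadsFor r ξ ∧ ∀ n,
      target n ∈ ξ.halfspaces ∧ r n ∉ (target n).carrier ∧
      (∀ h ∈ ξ.halfspaces, r n ∉ h.carrier → idx (target n) ≤ idx h) ∧
      (target n).distTo (r (n + 1)) < (target n).distTo (r n) := by
  have htarget (x : RAAG Γ) : ∃ h ∈ ξ.halfspaces, x ∉ h.carrier ∧
      ∀ k ∈ ξ.halfspaces, x ∉ k.carrier → idx h ≤ idx k := by
    obtain ⟨h, ⟨hh, hx⟩, hmin⟩ := exists_minimalFor_of_wellFoundedLT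
      (fun h => h ∈ ξ.halfspaces ∧ x ∉ h.carrier) idx (exists_mem_halfspaces_notMem ξ x)
    exact ⟨h, hh, hx, fun k hk hxk => (le_total _ _).elim id (hmin ⟨hk, hxk⟩)⟩
  choose target hmem hnot hmin using htarget
  choose next edge hends hsel hdist using fun x => exists_step_towards (hmem x) (hnot x)
  let r (n : ℕ) : RAAG Γ := next^[n] 1
  have hsucc (n : ℕ) : r (n + 1) = next (r n) := Function.iterate_succ_apply' _ _ _
  refine ⟨r, fun n => target (r n), fun n => ⟨edge (r n), ?_, ?_⟩, fun n =>
    ⟨hmem _, hnot _, hmin _, ?_⟩⟩ <;> rw [hsucc]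
  exacts [hends _, hsel _, hdist _]

instance [Countable V] : Countable (RAAG Γ) := by
  classical
  have : Countable (FreeGroup V) := FreeGroup.toWord_injective.countable
  exact (PresentedGroup.mk_surjective (relators Γ)).countable

instance [Countable V] : Countable (Edge Γ) :=
  Function.Injective.countable (f := fun e : Edge Γ => (e.base, e.label))
    fun _ _ h => Edge.ext (congrArg Prod.fst h) (congrArg Prod.snd h)

instance [Countable V] : Countable (Hyperplane Γ) :=
  inferInstanceAs (Countable (Quot _))

instance [Countable V] : Countable (Halfspace Γ) :=
  Function.Surjective.countable (f := fun p : Hyperplane Γ × RAAG Γ => halfspaceAt p.1 p.2)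
    fun h => h.nonempty.elim fun x hx => ⟨(h.boundary, x), (eq_halfspaceAt hx).symm⟩

/- While the target stays the same, the distance to it decreases; and it can change only finitely
often before `h`, since every halfspace once reached is never left again. -/
theorem exists_ray [Countable V] (ξ : RollerBoundary Γ) :
    ∃ r : ℕ → RAAG Γ, IsGeodesicRay Γ r ∧ Represents r ξ := by
  obtain ⟨idx, hidx⟩ := exists_injective_nat (Halfspace Γ)
  obtain ⟨r, target, hr, htarget⟩ := exists_headsFor_greedy ξ idx
  choose hmem hnot hmin hdist using htarget
  refine ⟨r, hr.isGeodesicRay, hr.represents fun h => ?_⟩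
  induction hk : idx h using Nat.strong_induction_on generalizing h with
  | _ k ih =>
  intro hh
  by_contra! hno
  have hearlier : ∀ᶠ n in Filter.atTop, ∀ l ∈ {l | idx l < k}, l ∈ ξ.halfspaces →
      r n ∈ l.carrier := by
    refine (Filter.eventually_all_finite ((Set.finite_lt_nat k).preimage hidx.injOn)).2
      fun l hl => Filter.eventually_imp_distrib_left.2 fun hlξ => ?_
    obtain ⟨m, hm⟩ := ih (idx l) hl l rfl hlξ
    exact Filter.eventually_atTop.2 ⟨m, fun n hn => hr.mem_of_le hlξ hn hm⟩
  obtain ⟨N, hN⟩ := Filter.eventually_atTop.1 hearlier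
  have htarget (n : ℕ) (hn : N ≤ n) : target n = h := by
    refine hidx (le_antisymm (hmin n h hh (hno n)) (not_lt.1 fun hlt => ?_))
    exact hnot n (hN n hn _ (hlt.trans_eq hk) (hmem n))
  refine not_strictAnti_of_wellFoundedLT (fun m => h.distTo (r (N + m)))
    (strictAnti_nat_of_succ_lt fun m => ?_)
  simpa only [htarget _ (Nat.le_add_right N m), add_assoc] using hdist (N + m)

/-! ### Standard subcomplexes as cosets -/

/-- The standard subcomplex of type `Λ` that contains the vertex `g`; its vertex set is the coset
`g * specialSubgroup Γ Λ`. -/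
def standard (Γ : SimpleGraph V) (g : RAAG Γ) (Λ : Set V) : Set (Cube Γ) :=
  {c | c.dirs ⊆ Λ ∧ g⁻¹ * c.base ∈ specialSubgroup Γ Λ}

theorem standard_mono {g : RAAG Γ} {Λ Λ' : Set V} (h : Λ ⊆ Λ') :
    standard Γ g Λ ⊆ standard Γ g Λ' :=
  fun _ hc => ⟨hc.1.trans h, specialSubgroup_mono h hc.2⟩

theorem standard_eq_of_inv_mul_mem {g g' : RAAG Γ} {Λ : Set V}
    (h : g⁻¹ * g' ∈ specialSubgroup Γ Λ) : standard Γ g Λ = standard Γ g' Λ := by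
  ext c
  refine and_congr_right fun _ => ?_
  have hmul : g⁻¹ * c.base = g⁻¹ * g' * (g'⁻¹ * c.base) := by group
  rw [hmul, Subgroup.mul_mem_cancel_left _ h]

theorem IsFacet.inv_mul_base_mem {Λ : Set V} {c' c : Cube Γ} (h : IsFacet c' c)
    (hc : c.dirs ⊆ Λ) : c.base⁻¹ * c'.base ∈ specialSubgroup Γ Λ := by
  obtain ⟨v, hv, -, hbase | hbase⟩ := h
  · simp only [hbase, inv_mul_cancel, one_mem]
  · simpa only [hbase, inv_mul_cancel_left] using gen_mem_specialSubgroup (hc hv)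

theorem component_subset_standard {Λ : Set V} {c : Cube Γ} (hc : c.dirs ⊆ Λ) :
    component (covering Γ ⁻¹' salvettiSub Γ Λ) c ⊆ standard Γ c.base Λ := by
  intro c' h
  induction h with
  | refl => exact ⟨hc, by simp only [inv_mul_cancel, one_mem]⟩
  | @tail b d _ hbd ih =>
    obtain ⟨hb, hd, hface⟩ := hbd
    have hstep : b.base⁻¹ * d.base ∈ specialSubgroup Γ Λ := by
      rcases hface with hface | hface
      · simpa only [mul_inv_rev, inv_inv] using inv_mem (hface.inv_mul_base_mem hd)
      · exact hface.inv_mul_base_mem hb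
    have hmul := mul_mem ih.2 hstep
    rw [mul_assoc, mul_inv_cancel_left] at hmul
    exact ⟨hd, hmul⟩

theorem mem_component_symm {S : Set (Cube Γ)} {c c' : Cube Γ} (h : c' ∈ component S c) :
    c ∈ component S c' := by
  induction h with
  | refl => exact Relation.ReflTransGen.refl
  | tail _ h ih => exact Relation.ReflTransGen.head ⟨h.2.1, h.1, h.2.2.symm⟩ ih

theorem vertexCube_mem_component {g : RAAG Γ} {σ Λ : Set V} (hσ : Γ.IsClique σ)
    (hfin : σ.Finite) (hΛ : σ ⊆ Λ) :
    vertexCube Γ g ∈ component (covering Γ ⁻¹' salvettiSub Γ Λ) ⟨g, σ, hσ⟩ := by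
  induction σ, hfin using Set.Finite.induction_on with
  | empty => exact Relation.ReflTransGen.refl
  | @insert v τ hv _ ih =>
    have hτ := Set.subset_insert v τ
    have hdirs : τ = insert v τ \ {v} := (Set.insert_sdiff_self_of_notMem hv).symm
    let c : Cube Γ := ⟨g, τ, hσ.subset hτ⟩
    have hc : c ∈ component (covering Γ ⁻¹' salvettiSub Γ Λ) ⟨g, insert v τ, hσ⟩ :=
      Relation.ReflTransGen.single
        ⟨hΛ, hτ.trans hΛ, Or.inr ⟨v, Set.mem_insert v τ, hdirs, Or.inl rfl⟩⟩
    exact hc.trans (ih (hσ.subset hτ) (hτ.trans hΛ))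

theorem vertexCube_mul_gen_mem_component {Λ : Set V} (x : RAAG Γ) {v : V} (hv : v ∈ Λ) :
    vertexCube Γ (x * gen Γ v) ∈
      component (covering Γ ⁻¹' salvettiSub Γ Λ) (vertexCube Γ x) := by
  have hedge : (Edge.toCube ⟨x, v⟩ : Cube Γ) ∈ covering Γ ⁻¹' salvettiSub Γ Λ :=
    Set.singleton_subset_iff.2 hv
  have hvertex (y : RAAG Γ) : vertexCube Γ y ∈ covering Γ ⁻¹' salvettiSub Γ Λ :=
    Set.empty_subset _
  have hdirs : (∅ : Set V) = {v} \ {v} := (Set.sdiff_self).symm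
  exact (Relation.ReflTransGen.single ⟨hvertex x, hedge, Or.inl ⟨v, rfl, hdirs, Or.inl rfl⟩⟩).tail
    ⟨hedge, hvertex _, Or.inr ⟨v, rfl, hdirs, Or.inr rfl⟩⟩

theorem vertexCube_mul_mem_component {Λ : Set V} (g : RAAG Γ) {u : RAAG Γ}
    (hu : u ∈ specialSubgroup Γ Λ) : vertexCube Γ (g * u) ∈
      component (covering Γ ⁻¹' salvettiSub Γ Λ) (vertexCube Γ g) :=
  rel_mul_of_mem_specialSubgroup
    ⟨fun x y => vertexCube Γ y ∈ component (covering Γ ⁻¹' salvettiSub Γ Λ) (vertexCube Γ x),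
      fun _ => Relation.ReflTransGen.refl, mem_component_symm, Relation.ReflTransGen.trans⟩
    (fun _ _ _ hv => vertexCube_mul_gen_mem_component _ hv) hu

theorem component_eq_standard [Finite V] {Λ : Set V} {c : Cube Γ} (hc : c.dirs ⊆ Λ) :
    component (covering Γ ⁻¹' salvettiSub Γ Λ) c = standard Γ c.base Λ := by
  refine (component_subset_standard hc).antisymm fun c' hc' => ?_
  have hvertex (d : Cube Γ) (hd : d.dirs ⊆ Λ) :
      vertexCube Γ d.base ∈ component (covering Γ ⁻¹' salvettiSub Γ Λ) d :=
    vertexCube_mem_component d.isClique (Set.toFinite _) hd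
  have hbases := vertexCube_mul_mem_component c.base hc'.2
  rw [mul_inv_cancel_left] at hbases
  exact ((hvertex c hc).trans hbases).trans (mem_component_symm (hvertex c' hc'.1))

theorem isStandardOfType_iff [Finite V] {Λ : Set V} {Y : Set (Cube Γ)} :
    IsStandardOfType Γ Λ Y ↔ ∃ g, Y = standard Γ g Λ := by
  refine ⟨fun ⟨c, hc, hY⟩ => ⟨c.base, hY.trans (component_eq_standard hc)⟩, fun ⟨g, hY⟩ => ?_⟩
  have hg : (vertexCube Γ g).dirs ⊆ Λ := Set.empty_subset _
  exact ⟨vertexCube Γ g, hg, hY.trans (component_eq_standard hg).symm⟩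

theorem isStandard_iff [Finite V] {Y : Set (Cube Γ)} :
    IsStandard Γ Y ↔ ∃ g Λ, Y = standard Γ g Λ := by
  simp only [IsStandard, isStandardOfType_iff]
  exact exists_comm

theorem isStandard_standard [Finite V] (g : RAAG Γ) (Λ : Set V) : IsStandard Γ (standard Γ g Λ) :=
  isStandard_iff.2 ⟨g, Λ, rfl⟩

instance [Finite V] : Countable (StandardInJoin Γ) := by
  choose g Λ h using fun Y : StandardInJoin Γ => isStandard_iff.1 Y.2.1
  refine Function.Injective.countable (f := fun Y => (g Y, Λ Y)) fun Y Y' hYY' => Subtype.ext ?_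
  obtain ⟨hg, hΛ⟩ := Prod.ext_iff.1 hYY'
  exact (h Y).trans ((congrArg₂ (standard Γ) hg hΛ).trans (h Y').symm)

/-! ### Virtual containment -/

section VirtuallyContains

variable {r : ℕ → RAAG Γ} {ξ : RollerBoundary Γ}

theorem IsGeodesicRay.inv_mul_mem (hr : IsGeodesicRay Γ r) {Λ : Set V} {m n : ℕ} (hmn : m ≤ n)
    (h : ∀ i ≥ m, (hr.edge i).label ∈ Λ) : (r m)⁻¹ * r n ∈ specialSubgroup Γ Λ := by
  refine inv_mul_mem_specialSubgroup_of_label_mem fun K hK => ?_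
  obtain ⟨i, hi, -, rfl⟩ := hr.exists_edge_dual_eq hmn hK
  exact h i hi

theorem virtuallyContains_standard_iff (hr : IsGeodesicRay Γ r) {g : RAAG Γ} {Λ : Set V} :
    VirtuallyContains (standard Γ g Λ) r ↔ ∃ N, g⁻¹ * r N ∈ specialSubgroup Γ Λ ∧
      ∀ n ≥ N, (hr.edge n).label ∈ Λ := by
  refine ⟨fun ⟨N, hN⟩ => ⟨N, (hN N le_rfl).1.2, fun n hn =>
    ((hN n hn).2 _ (hr.ends_edge n)).1 rfl⟩, fun ⟨N, hmem, hlabel⟩ => ?_⟩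
  have hcoset (n : ℕ) (hn : N ≤ n) : g⁻¹ * r n ∈ specialSubgroup Γ Λ := by
    simpa only [mul_assoc, mul_inv_cancel_left] using mul_mem hmem (hr.inv_mul_mem hn hlabel)
  refine ⟨N, fun n hn => ⟨⟨Set.empty_subset _, hcoset n hn⟩, fun e he => ⟨?_, ?_⟩⟩⟩
  · have hdual : (hr.edge n).dual = e.dual :=
      (Edge.separates_iff (hr.ends_edge n)).1 (Edge.dual_separates he)
    have hlab : (hr.edge n).label = e.label := congrArg Hyperplane.label hdual
    exact Set.singleton_subset_iff.2 (hlab ▸ hlabel n hn)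
  · change g⁻¹ * e.base ∈ _
    rcases Edge.ends_eq_iff.1 he with ⟨hbase, -⟩ | ⟨hbase, -⟩
    · exact hbase ▸ hcoset n hn
    · exact hbase ▸ hcoset (n + 1) (hn.trans n.le_succ)

/-- The set of boundary points that are separated from some vertex of `standard Γ g Λ` by
hyperplanes with labels in `Λ` only; these are the limit points of the standard subcomplex. -/
def limitSet (g : RAAG Γ) (Λ : Set V) : Set (RollerBoundary Γ) :=
  {ξ | ∃ x, g⁻¹ * x ∈ specialSubgroup Γ Λ ∧
    ∀ h ∈ ξ.halfspaces, x ∈ h.carrier ∨ h.boundary.label ∈ Λ}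

theorem exists_halfspaceAt_mem (ξ : RollerBoundary Γ) (K : Hyperplane Γ) :
    ∃ x, halfspaceAt K x ∈ ξ.halfspaces := by
  obtain ⟨y, hy⟩ := K.exists_separates 1
  by_cases hyξ : halfspaceAt K y ∈ ξ.halfspaces
  · exact ⟨y, hyξ⟩
  · exact ⟨1, (halfspaceAt_mem_iff ξ hy).2 hyξ⟩

theorem Represents.eventually_halfspaceAt_mem (hξ : Represents r ξ) (K : Hyperplane Γ) :
    ∀ᶠ n in Filter.atTop, halfspaceAt K (r n) ∈ ξ.halfspaces := by
  obtain ⟨x, hx⟩ := exists_halfspaceAt_mem ξ K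
  filter_upwards [Filter.eventually_atTop.2 ((hξ _).1 hx)] with n hn
  rwa [← halfspaceAt_congr (mem_halfspaceAt.1 hn)]

/- Only finitely many hyperplanes separate `x` from the origin of the ray, and the ray never crosses
a hyperplane back. -/
theorem Represents.eventually_forall_separates (hξ : Represents r ξ) (hr : IsGeodesicRay Γ r)
    (x : RAAG Γ) : ∀ᶠ n in Filter.atTop, ∀ K : Hyperplane Γ, K.Separates x (r n) →
      halfspaceAt K (r n) ∈ ξ.halfspaces := by
  filter_upwards [(Filter.eventually_all_finite (finite_separates (r 0) x)).2
    fun K _ => hξ.eventually_halfspaceAt_mem K] with n hn K hK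
  by_cases hK₀ : K.side (r 0) = K.side x
  · exact hξ.halfspaceAt_mem hr n.zero_le fun h => hK (hK₀.symm.trans h)
  · exact hn K hK₀

theorem Represents.virtuallyContains_iff (hξ : Represents r ξ) (hr : IsGeodesicRay Γ r)
    {g : RAAG Γ} {Λ : Set V} :
    VirtuallyContains (standard Γ g Λ) r ↔ ξ ∈ limitSet g Λ := by
  rw [virtuallyContains_standard_iff hr]
  constructor
  · rintro ⟨N, hmem, hlabel⟩
    refine ⟨r N, hmem, fun h hh => or_iff_not_imp_left.2 fun hN => ?_⟩
    obtain ⟨M, hM⟩ := (hξ h).1 hh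
    obtain ⟨i, hi, -, hdual⟩ := hr.exists_edge_dual_eq (le_max_left N M)
      (Halfspace.separates_iff.2 fun hiff => hN (hiff.2 (hM _ (le_max_right N M))))
    exact hdual ▸ hlabel i hi
  · rintro ⟨x, hx, hlab⟩
    obtain ⟨N, hN⟩ := Filter.eventually_atTop.1 (hξ.eventually_forall_separates hr x)
    have hlabel (n : ℕ) (hn : N ≤ n) (K : Hyperplane Γ) (hK : K.Separates x (r n)) :
        K.label ∈ Λ :=
      (hlab _ (hN n hn K hK)).resolve_left fun hmem => hK (mem_halfspaceAt.1 hmem).symm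
    refine ⟨N, ?_, fun n hn => ?_⟩
    · simpa only [mul_assoc, mul_inv_cancel_left] using
        mul_mem hx (inv_mul_mem_specialSubgroup_of_label_mem (hlabel N le_rfl))
    · by_cases hs : (hr.edge n).dual.side x = (hr.edge n).dual.side (r n)
      · exact hlabel (n + 1) (hn.trans n.le_succ) (hr.edge n).dual fun hs' =>
          Edge.dual_separates (hr.ends_edge n) (hs.symm.trans hs')
      · exact hlabel n hn (hr.edge n).dual hs

end VirtuallyContains

/-! ### The smallest standard subcomplex -/

section Smallest

variable {r : ℕ → RAAG Γ} {ξ : RollerBoundary Γ}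

/-- The labels that occur infinitely often along a geodesic ray; they span the smallest standard
subcomplex that virtually contains the ray. -/
def IsGeodesicRay.recurrentLabels (hr : IsGeodesicRay Γ r) : Set V :=
  {v | ∃ᶠ n in Filter.atTop, (hr.edge n).label = v}

theorem IsGeodesicRay.eventually_label_mem [Finite V] (hr : IsGeodesicRay Γ r) :
    ∀ᶠ n in Filter.atTop, (hr.edge n).label ∈ hr.recurrentLabels := by
  have hrare : ∀ᶠ n in Filter.atTop, ∀ v, v ∉ hr.recurrentLabels → (hr.edge n).label ≠ v :=
    Filter.eventually_all.2 fun v =>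
      Filter.eventually_imp_distrib_left.2 fun hv => Filter.not_frequently.1 hv
  exact hrare.mono fun n hn => not_not.1 fun hv => hn _ hv rfl

theorem IsGeodesicRay.isLeast_standard [Finite V] (hr : IsGeodesicRay Γ r) {N : ℕ}
    (hN : ∀ n ≥ N, (hr.edge n).label ∈ hr.recurrentLabels) :
    IsLeast {Z : Set (Cube Γ) | IsStandard Γ Z ∧ VirtuallyContains Z r}
      (standard Γ (r N) hr.recurrentLabels) := by
  refine ⟨⟨isStandard_standard _ _, (virtuallyContains_standard_iff hr).2
    ⟨N, by simp only [inv_mul_cancel, one_mem], hN⟩⟩, ?_⟩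
  rintro Z ⟨hZ, hZr⟩
  obtain ⟨g, Λ, rfl⟩ := isStandard_iff.1 hZ
  obtain ⟨M, hM, hMlabel⟩ := (virtuallyContains_standard_iff hr).1 hZr
  have hsub : hr.recurrentLabels ⊆ Λ := fun v hv => by
    obtain ⟨n, hn, rfl⟩ := Filter.frequently_atTop.1 hv M
    exact hMlabel n hn
  have hmax : g⁻¹ * r (max N M) ∈ specialSubgroup Γ Λ := by
    simpa only [mul_assoc, mul_inv_cancel_left] using
      mul_mem hM (hr.inv_mul_mem (le_max_right N M) hMlabel)
  rw [standard_eq_of_inv_mul_mem (hr.inv_mul_mem (le_max_left N M) hN),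
    standard_eq_of_inv_mul_mem hmax]
  exact standard_mono hsub

theorem Represents.isLeast_iff [Finite V] (hξ : Represents r ξ) (hr : IsGeodesicRay Γ r)
    {Y : Set (Cube Γ)} :
    IsLeast {Z : Set (Cube Γ) | IsStandard Γ Z ∧ VirtuallyContains Z r} Y ↔
      IsLeast {Z : Set (Cube Γ) | ∃ g Λ, Z = standard Γ g Λ ∧ ξ ∈ limitSet g Λ} Y := by
  refine iff_of_eq (congrArg (IsLeast · Y) (Set.ext fun Z => ⟨?_, ?_⟩))
  · rintro ⟨hZ, hZr⟩
    obtain ⟨g, Λ, rfl⟩ := isStandard_iff.1 hZ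
    exact ⟨g, Λ, rfl, (hξ.virtuallyContains_iff hr).1 hZr⟩
  · rintro ⟨g, Λ, rfl, hlim⟩
    exact ⟨isStandard_standard g Λ, (hξ.virtuallyContains_iff hr).2 hlim⟩

theorem isSmallestFor_iff [Finite V] {Y : Set (Cube Γ)} : IsSmallestFor Y ξ ↔
    IsLeast {Z : Set (Cube Γ) | ∃ g Λ, Z = standard Γ g Λ ∧ ξ ∈ limitSet g Λ} Y := by
  refine ⟨fun h => ?_, fun h r hr hξ => (hξ.isLeast_iff hr).2 h⟩
  obtain ⟨r, hr, hξ⟩ := exists_ray ξ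
  exact (hξ.isLeast_iff hr).1 (h r hr hξ)

theorem IsSmallestFor.unique [Finite V] {Y Y' : Set (Cube Γ)}
    (h : IsSmallestFor Y ξ) (h' : IsSmallestFor Y' ξ) : Y = Y' :=
  (isSmallestFor_iff.1 h).unique (isSmallestFor_iff.1 h')

theorem isSmallestFor_standard_iff [Finite V] {g : RAAG Γ} {Λ : Set V} :
    IsSmallestFor (standard Γ g Λ) ξ ↔ ξ ∈ limitSet g Λ ∧
      ∀ (k : RAAG Γ) (Λ' : Set V), ξ ∈ limitSet k Λ' → standard Γ g Λ ⊆ standard Γ k Λ' := by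
  obtain ⟨r, hr, hξ⟩ := exists_ray ξ
  rw [isSmallestFor_iff, ← hξ.isLeast_iff hr, IsLeast, mem_lowerBounds, Set.mem_ofPred_eq,
    hξ.virtuallyContains_iff hr, and_iff_right (isStandard_standard g Λ)]
  refine and_congr_right fun _ => ⟨fun h k Λ' hk => ?_, fun h Z hZ => ?_⟩
  · exact h _ ⟨isStandard_standard k Λ', (hξ.virtuallyContains_iff hr).2 hk⟩
  · obtain ⟨k, Λ', rfl⟩ := isStandard_iff.1 hZ.1
    exact h k Λ' ((hξ.virtuallyContains_iff hr).1 hZ.2)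

end Smallest

/-! ### Equivariance -/

section Equivariance

variable {r : ℕ → RAAG Γ} {ξ : RollerBoundary Γ}

theorem IsGeodesicRay.smul (hr : IsGeodesicRay Γ r) (k : RAAG Γ) :
    IsGeodesicRay Γ fun n => k * r n :=
  fun m n => (dist_mul_left k _ _).trans (hr m n)

theorem Represents.smul (hξ : Represents r ξ) (k : RAAG Γ) :
    Represents (fun n => k * r n) (k • ξ) := fun h => by
  simpa only [mem_halfspaces_smul, smul_carrier, Set.mem_smul_set_iff_inv_smul_mem, inv_inv,
    smul_eq_mul] using hξ (k⁻¹ • h)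

theorem VirtuallyContains.smul {Y : Set (Cube Γ)} (h : VirtuallyContains Y r) (k : RAAG Γ) :
    VirtuallyContains (k • Y) fun n => k * r n := by
  obtain ⟨N, hN⟩ := h
  refine ⟨N, fun n hn => ⟨⟨_, (hN n hn).1, rfl⟩, fun e he => ?_⟩⟩
  exact Set.mem_smul_set_iff_inv_smul_mem.2 ((hN n hn).2 _ (ends_eq_smul.1 he))

theorem IsSmallestFor.smul {Y : Set (Cube Γ)} (h : IsSmallestFor Y ξ) (k : RAAG Γ) :
    IsSmallestFor (k • Y) (k • ξ) := by
  intro r hr hξ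
  have hξ' := hξ.smul k⁻¹
  rw [inv_smul_smul] at hξ'
  obtain ⟨⟨⟨Λ, hY⟩, hYr⟩, hmin⟩ := h _ (hr.smul k⁻¹) hξ'
  refine ⟨⟨⟨Λ, hY.smul k⟩, ?_⟩, fun Z ⟨⟨Λ', hZ⟩, hZr⟩ => ?_⟩
  · simpa only [mul_inv_cancel_left] using hYr.smul k
  · exact Set.smul_set_subset_iff_subset_inv_smul_set.2
      (hmin ⟨⟨Λ', hZ.smul k⁻¹⟩, hZr.smul k⁻¹⟩)

end Equivariance

/-! ### Measurability -/

section Measurability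

theorem measurable_mem_halfspaces (h : Halfspace Γ) :
    Measurable fun ξ : RollerBoundary Γ => h ∈ ξ.halfspaces := by
  have hcont : Continuous fun ξ : RollerBoundary Γ => ξ.1 h :=
    (continuous_apply h).comp continuous_subtype_val
  exact measurableSet_setOfPred.1 ((isOpen_discrete {true}).preimage hcont).measurableSet

theorem measurableSet_regularPoints [Countable V] : MeasurableSet (regularPoints Γ) :=
  measurableSet_setOfPred.2 <|
    Measurable.forall fun h₁ => (measurable_mem_halfspaces h₁).imp <|
      Measurable.forall fun h₂ => (measurable_mem_halfspaces h₂).imp <|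
        Measurable.exists fun k => (measurable_mem_halfspaces k).and measurable_const

theorem measurableSet_limitSet [Countable V] (g : RAAG Γ) (Λ : Set V) :
    MeasurableSet (limitSet g Λ) :=
  measurableSet_setOfPred.2 <| Measurable.exists fun _ => measurable_const.and <|
    Measurable.forall fun h => (measurable_mem_halfspaces h).imp measurable_const

theorem measurableSet_isSmallestFor [Finite V] {Y : Set (Cube Γ)} (hY : IsStandard Γ Y) :
    MeasurableSet {ξ : RollerBoundary Γ | IsSmallestFor Y ξ} := by
  obtain ⟨g, Λ, rfl⟩ := isStandard_iff.1 hY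
  simp only [isSmallestFor_standard_iff]
  have hlim (k : RAAG Γ) (Λ' : Set V) : Measurable fun ξ : RollerBoundary Γ => ξ ∈ limitSet k Λ' :=
    measurableSet_setOfPred.1 (measurableSet_limitSet k Λ')
  exact measurableSet_setOfPred.2 <| (hlim g Λ).and <| Measurable.forall fun k =>
    Measurable.forall fun Λ' => (hlim k Λ').imp measurable_const

theorem measurable_of_isSmallestFor [Finite V] {Φ : NonRegular Γ → StandardInJoin Γ}
    (hΦ : ∀ ξ, IsSmallestFor (Φ ξ).1 ξ.1) : Measurable Φ := by
  refine measurable_to_countable' fun Y => ?_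
  have hpreimage : Φ ⁻¹' {Y} = Subtype.val ⁻¹' {ξ | IsSmallestFor Y.1 ξ} := by
    ext ξ
    exact ⟨fun h => (h : Φ ξ = Y) ▸ hΦ ξ, fun h => Subtype.ext ((hΦ ξ).unique h)⟩
  rw [hpreimage]
  exact measurable_subtype_coe (measurableSet_isSmallestFor Y.2.1)

end Measurability

/-! ### Regular points -/

section Regular

variable {ξ : RollerBoundary Γ}

theorem StronglySeparated.of_subset {h k l : Halfspace Γ}
    (hsep : StronglySeparated k.boundary l.boundary) (hkl : k.carrier ⊆ l.carrier)
    (hlh : l.carrier ⊆ h.carrier) : StronglySeparated k.boundary h.boundary :=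
  fun ⟨L, hk, hh⟩ => hsep ⟨L, hk, meets_of_subset hkl hlh hk hh⟩

theorem StronglySeparated.not_subset {h k : Halfspace Γ}
    (hsep : StronglySeparated k.boundary h.boundary) (hkh : k.carrier ⊆ h.carrier) :
    ¬ h.carrier ⊆ k.carrier := fun hhk =>
  hsep ⟨k.boundary, Or.inl rfl, Or.inl (boundary_eq_of_carrier_eq (hkh.antisymm hhk))⟩

theorem finite_subset_and_mem (k : Halfspace Γ) (x : RAAG Γ) :
    {h : Halfspace Γ | h.carrier ⊆ k.carrier ∧ x ∈ h.carrier}.Finite := by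
  obtain ⟨y, hy⟩ := k.exists_notMem
  refine ((finite_separates x y).image (halfspaceAt · x)).subset fun h ⟨hk, hx⟩ => ?_
  exact ⟨h.boundary, Halfspace.separates_iff.2 fun hiff => hy (hk (hiff.1 hx)),
    (eq_halfspaceAt hx).symm⟩

variable {A : Set (Halfspace Γ)}

theorem exists_subset_notMem (hA : ∀ h ∈ A, ∃ k ∈ A, k.carrier ⊆ h.carrier ∧
    StronglySeparated k.boundary h.boundary) {h : Halfspace Γ} (hh : h ∈ A) (x : RAAG Γ) :
    ∃ k ∈ A, k.carrier ⊆ h.carrier ∧ x ∉ k.carrier := by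
  by_contra! hno
  have hfin : {k ∈ A | k.carrier ⊆ h.carrier}.Finite :=
    (finite_subset_and_mem h x).subset fun k hk => ⟨hk.2, hno k hk.1 hk.2⟩
  obtain ⟨k, ⟨hkA, hkh⟩, hmin⟩ := hfin.exists_minimalFor Halfspace.carrier _ ⟨h, hh, subset_rfl⟩
  obtain ⟨l, hlA, hlk, hsep⟩ := hA k hkA
  exact hsep.not_subset hlk (hmin ⟨hlA, hlk.trans hkh⟩ hlk)

theorem exists_subset_of_mem_halfspaces (hAξ : A ⊆ ξ.halfspaces)
    (hA : ∀ h ∈ A, ∃ k ∈ A, k.carrier ⊆ h.carrier ∧ StronglySeparated k.boundary h.boundary)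
    {a h : Halfspace Γ} (ha : a ∈ A) (hh : h ∈ ξ.halfspaces) :
    ∃ k ∈ A, k.carrier ⊆ a.carrier ∧ k.carrier ⊆ h.carrier := by
  obtain ⟨y, hy⟩ := h.nonempty
  obtain ⟨z, hz⟩ := h.exists_notMem
  obtain ⟨b, hb, hba, hyb⟩ := exists_subset_notMem hA ha y
  obtain ⟨c, hc, hcb, hzc⟩ := exists_subset_notMem hA hb z
  obtain ⟨d, hd, hdc, hsep⟩ := hA c hc
  have hsub (k : Halfspace Γ) (hk : k ∈ A) (hkc : k.carrier ⊆ c.carrier)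
      (hcross : ¬ h.boundary.Crosses k.boundary) : k.carrier ⊆ h.carrier := by
    rcases subset_or_subset_of_not_crosses hcross (exists_mem_inter hh (hAξ hk))
      with hkh | hhk | hhk
    · exact hkh
    · exact absurd (hcb (hkc (hhk hy))) hyb
    · exact absurd (hkc (hhk hz)) hzc
  by_cases hcross : h.boundary.Crosses c.boundary
  · exact ⟨d, hd, hdc.trans (hcb.trans hba),
      hsub d hd hdc fun hcross' => hsep ⟨_, hcross'.meets, hcross.meets⟩⟩
  · exact ⟨c, hc, hcb.trans hba, hsub c hc subset_rfl hcross⟩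

theorem mem_regularPoints_of_nested (hne : A.Nonempty) (hAξ : A ⊆ ξ.halfspaces)
    (hA : ∀ h ∈ A, ∃ k ∈ A, k.carrier ⊆ h.carrier ∧
      StronglySeparated k.boundary h.boundary) : ξ ∈ regularPoints Γ := by
  intro h₁ hh₁ h₂ hh₂
  obtain ⟨a, ha⟩ := hne
  obtain ⟨b, hb, -, hb₁⟩ := exists_subset_of_mem_halfspaces hAξ hA ha hh₁
  obtain ⟨c, hc, hcb, hc₂⟩ := exists_subset_of_mem_halfspaces hAξ hA hb hh₂
  obtain ⟨k, hk, hkc, hsep⟩ := hA c hc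
  have hc₁ := hcb.trans hb₁
  exact ⟨k, hAξ hk, Set.subset_inter (hkc.trans hc₁) (hkc.trans hc₂),
    hsep.of_subset hkc hc₁, hsep.of_subset hkc hc₂⟩

end Regular

/-! ### Subgraphs that are not joins -/

section Join

variable {Λ : Set V}

theorem reflTransGen_of_not_isJoin (hΛ : ¬ IsJoin Γ Λ) {a b : V} (ha : a ∈ Λ) (hb : b ∈ Λ) :
    Relation.ReflTransGen (fun x y => y ∈ Λ ∧ ¬ Γ.Adj x y) a b := by
  by_contra hab
  let C : Set V := {x | Relation.ReflTransGen (fun x y => y ∈ Λ ∧ ¬ Γ.Adj x y) a x}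
  refine hΛ ⟨Λ ∩ C, Λ \ C, ⟨a, ha, .refl⟩, ⟨b, hb, hab⟩,
    Set.disjoint_sdiff_right.mono_left Set.inter_subset_right, Set.inter_union_sdiff Λ C, ?_⟩
  rintro x ⟨-, hx⟩ y ⟨hy, hay⟩
  by_contra hxy
  exact hay (Relation.ReflTransGen.tail hx ⟨hy, hxy⟩)

theorem isJoin_insert_of_forall_adj (hΛ : Λ.Nonempty) {b : V} (hb : ∀ a ∈ Λ, Γ.Adj b a) :
    IsJoin Γ (insert b Λ) := by
  refine ⟨{b}, Λ, Set.singleton_nonempty b, hΛ, ?_, rfl, ?_⟩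
  · exact Set.disjoint_singleton_left.2 fun h => Γ.irrefl (hb b h)
  · rintro _ rfl a ha
    exact hb a ha

end Join

/-! ### Halfspaces entered by a ray -/

section Entered

variable {r : ℕ → RAAG Γ} {ξ : RollerBoundary Γ}

/-- The halfspace that a geodesic ray enters along its `n`-th edge. -/
noncomputable def IsGeodesicRay.entered (hr : IsGeodesicRay Γ r) (n : ℕ) : Halfspace Γ :=
  halfspaceAt (hr.edge n).dual (r (n + 1))

theorem IsGeodesicRay.mem_entered_iff (hr : IsGeodesicRay Γ r) {m n : ℕ} :
    r m ∈ (hr.entered n).carrier ↔ n < m := by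
  have hsep := hr.edge_dual_separates n.lt_succ_self
  rw [entered, mem_halfspaceAt]
  refine ⟨fun hside => ?_, fun hnm => hr.side_eq n.le_succ hnm hsep⟩
  by_contra! hmn
  exact hsep (hr.side_eq hmn n.le_succ fun h => hsep (h.symm.trans hside.symm))

theorem Represents.entered_mem (hξ : Represents r ξ) (hr : IsGeodesicRay Γ r) (n : ℕ) :
    hr.entered n ∈ ξ.halfspaces :=
  hξ.halfspaceAt_mem hr n.le_succ (hr.edge_dual_separates n.lt_succ_self)

theorem IsGeodesicRay.entered_subset (hr : IsGeodesicRay Γ r) {i j : ℕ} (hij : i < j)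
    (hadj : ¬ Γ.Adj (hr.edge i).label (hr.edge j).label) :
    (hr.entered j).carrier ⊆ (hr.entered i).carrier := by
  have hcross : ¬ (hr.entered i).boundary.Crosses (hr.entered j).boundary :=
    fun hc => hadj hc.adj_label
  have hboth : r (j + 1) ∈ (hr.entered i).carrier ∩ (hr.entered j).carrier :=
    ⟨hr.mem_entered_iff.2 (by omega), hr.mem_entered_iff.2 (by omega)⟩
  rcases subset_or_subset_of_not_crosses hcross ⟨_, hboth⟩ with hsub | hsub | hsub
  · exact hsub
  · have := hr.mem_entered_iff.1 (hsub (hr.mem_entered_iff.2 i.lt_succ_self))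
    omega
  · have := hr.mem_entered_iff.1 (hsub (a := r i) fun h => (hr.mem_entered_iff.1 h).false)
    omega

theorem IsGeodesicRay.exists_entered_subset_of_not_adj (hr : IsGeodesicRay Γ r) {v : V}
    (hv : v ∈ hr.recurrentLabels) {i : ℕ} (hadj : ¬ Γ.Adj (hr.edge i).label v) :
    ∃ j > i, (hr.edge j).label = v ∧ (hr.entered j).carrier ⊆ (hr.entered i).carrier := by
  obtain ⟨j, hij, rfl⟩ := Filter.frequently_atTop'.1 hv i
  exact ⟨j, hij, rfl, hr.entered_subset hij hadj⟩

theorem IsGeodesicRay.exists_entered_subset (hr : IsGeodesicRay Γ r)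
    (hjoin : ¬ IsJoin Γ hr.recurrentLabels) {i : ℕ}
    (hi : (hr.edge i).label ∈ hr.recurrentLabels) {v : V} (hv : v ∈ hr.recurrentLabels) :
    ∃ j > i, (hr.edge j).label = v ∧ (hr.entered j).carrier ⊆ (hr.entered i).carrier := by
  have hpath := reflTransGen_of_not_isJoin hjoin hi hv
  clear hv
  induction hpath with
  | refl => exact hr.exists_entered_subset_of_not_adj hi Γ.irrefl
  | tail _ hstep ih =>
    obtain ⟨hc, hbc⟩ := hstep
    obtain ⟨j, hij, rfl, hji⟩ := ih
    obtain ⟨k, hjk, hk, hkj⟩ := hr.exists_entered_subset_of_not_adj hc hbc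
    exact ⟨k, hij.trans hjk, hk, hkj.trans hji⟩

/- A hyperplane that crosses the boundaries of two nested halfspaces crosses the boundary of every
halfspace in between, so it suffices to enter halfspaces with all labels in `S` one after the
other. -/
theorem IsGeodesicRay.exists_entered_subset_forall_adj (hr : IsGeodesicRay Γ r)
    (hjoin : ¬ IsJoin Γ hr.recurrentLabels) {i : ℕ}
    (hi : (hr.edge i).label ∈ hr.recurrentLabels) {S : Set V} (hfin : S.Finite)
    (hS : S ⊆ hr.recurrentLabels) :
    ∃ j > i, (hr.edge j).label ∈ hr.recurrentLabels ∧
      (hr.entered j).carrier ⊆ (hr.entered i).carrier ∧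
      ∀ L : Hyperplane Γ, L.Crosses (hr.entered j).boundary →
        L.Crosses (hr.entered i).boundary → ∀ s ∈ S, Γ.Adj L.label s := by
  induction S, hfin using Set.Finite.induction_on with
  | empty =>
    obtain ⟨j, hij, hj, hji⟩ := hr.exists_entered_subset hjoin hi hi
    exact ⟨j, hij, hj ▸ hi, hji, fun _ _ _ s hs => hs.elim⟩
  | @insert v S _ _ ih =>
    obtain ⟨hv, hS⟩ := Set.insert_subset_iff.1 hS
    obtain ⟨j, hij, hj, hji, hadj⟩ := ih hS
    obtain ⟨k, hjk, rfl, hkj⟩ := hr.exists_entered_subset hjoin hj hv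
    refine ⟨k, hij.trans hjk, hv, hkj.trans hji, fun L hLk hLi s hs => ?_⟩
    rcases hs with rfl | hs
    · exact hLk.adj_label
    · exact hadj L (crosses_of_subset hkj hji hLk hLi) hLi s hs

theorem IsGeodesicRay.exists_stronglySeparated_entered [Finite V] (hr : IsGeodesicRay Γ r)
    (hno : ∀ Λ, IsJoin Γ Λ → ¬ hr.recurrentLabels ⊆ Λ) {i : ℕ}
    (hi : (hr.edge i).label ∈ hr.recurrentLabels) :
    ∃ j, (hr.edge j).label ∈ hr.recurrentLabels ∧
      (hr.entered j).carrier ⊆ (hr.entered i).carrier ∧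
      StronglySeparated (hr.entered j).boundary (hr.entered i).boundary := by
  have hjoin : ¬ IsJoin Γ hr.recurrentLabels := fun h => hno _ h subset_rfl
  obtain ⟨j, hij, hj, hji, hadj⟩ :=
    hr.exists_entered_subset_forall_adj hjoin hi (Set.toFinite _) subset_rfl
  refine ⟨j, hj, hji, stronglySeparated_of_subset hji (fun hb => ?_) fun L hLj hLi =>
    hno _ (isJoin_insert_of_forall_adj ⟨_, hi⟩ (hadj L hLj hLi)) (Set.subset_insert _ _)⟩
  have hmem : r (i + 1) ∈ (hr.entered j).carrier :=
    eq_of_subset_of_boundary_eq hji hb ▸ hr.mem_entered_iff.2 i.lt_succ_self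
  exact absurd (hr.mem_entered_iff.1 hmem) (not_lt.2 hij)

theorem Represents.exists_isJoin [Finite V] (hξ : Represents r ξ) (hr : IsGeodesicRay Γ r)
    (hreg : ξ ∉ regularPoints Γ) : ∃ Λ, IsJoin Γ Λ ∧ hr.recurrentLabels ⊆ Λ := by
  by_contra! hno
  obtain ⟨N, hN⟩ := hr.eventually_label_mem.exists
  refine hreg (mem_regularPoints_of_nested
    (A := hr.entered '' {n | (hr.edge n).label ∈ hr.recurrentLabels}) ⟨_, N, hN, rfl⟩ ?_ ?_)
  · rintro _ ⟨n, -, rfl⟩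
    exact hξ.entered_mem hr n
  · rintro _ ⟨i, hi, rfl⟩
    obtain ⟨j, hj, hji⟩ := hr.exists_stronglySeparated_entered hno hi
    exact ⟨_, ⟨j, hj, rfl⟩, hji⟩

theorem exists_isSmallestFor [Finite V] (ξ : NonRegular Γ) :
    ∃ Y : StandardInJoin Γ, IsSmallestFor Y.1 ξ.1 := by
  obtain ⟨r, hr, hξ⟩ := exists_ray ξ.1
  obtain ⟨N, hN⟩ := Filter.eventually_atTop.1 hr.eventually_label_mem
  obtain ⟨Λ, hΛ, hsub⟩ := hξ.exists_isJoin hr ξ.2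
  exact ⟨⟨standard Γ (r N) hr.recurrentLabels, isStandard_standard _ _,
    standard Γ (r N) Λ, ⟨Λ, hΛ, isStandardOfType_iff.2 ⟨_, rfl⟩⟩, standard_mono hsub⟩,
    isSmallestFor_iff.2 ((hξ.isLeast_iff hr).1 (hr.isLeast_standard hN))⟩

end Entered

end Salvetti

theorem theorem7 {V : Type*} [Finite V] (Γ : SimpleGraph V) :
    MeasurableSet (Salvetti.regularPoints Γ) ∧
    (∀ ξ : Salvetti.NonRegular Γ,
      ∃! Y : Set (Salvetti.Cube Γ), Salvetti.IsStandard Γ Y ∧ Salvetti.IsSmallestFor Y ξ.1) ∧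
    ∃! Φ : Salvetti.NonRegular Γ → Salvetti.StandardInJoin Γ,
      Measurable Φ ∧
      (∀ (g : Salvetti.RAAG Γ) (ξ : Salvetti.NonRegular Γ), Φ (g • ξ) = g • Φ ξ) ∧
      ∀ ξ : Salvetti.NonRegular Γ, Salvetti.IsSmallestFor (Φ ξ).1 ξ.1 := by
  choose Φ hΦ using fun ξ : Salvetti.NonRegular Γ => Salvetti.exists_isSmallestFor ξ
  refine ⟨Salvetti.measurableSet_regularPoints, fun ξ => ⟨(Φ ξ).1, ⟨(Φ ξ).2.1, hΦ ξ⟩,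
    fun Y hY => hY.2.unique (hΦ ξ)⟩, Φ, ⟨?measurable, ?equivariant, hΦ⟩, ?unique⟩
  case measurable => exact Salvetti.measurable_of_isSmallestFor hΦ
  case equivariant =>
    exact fun g ξ => Subtype.ext ((hΦ (g • ξ)).unique ((hΦ ξ).smul g))
  case unique =>
    rintro Ψ ⟨-, -, hΨ⟩
    exact funext fun ξ => Subtype.ext ((hΨ ξ).unique (hΦ ξ))
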